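/- A \emph{moment category} is a category with two classes of morphisms, called active and inert, each containing all isomorphisms and closed under composition, such that every morphism factors as an active morphism followed by an inert one, uniquely up to a unique isomorphism, and such that (M1) every inert morphism has a unique active retraction; (M2) if $fi=g$ with $i$ inert and $f,g$ active, then $f=gr$ for the active retraction $r$ of $i$. A \emph{moment} of $A$ is an endomorphism $\phi$ with active/inert factorisation $\phi=ir$ such that $ri=1$; it \emph{splits over} the domain of $i$. Write $m_A$ for the set of moments of $A$, and $\phi\le\psi$ if $\psi\phi=\phi$. The moments $\phi,\psi$ are \emph{congruent} if $\phi=\phi\psi\phi$ and $\psi=\psi\phi\psi$, and a moment is \emph{centric} if it is congruent only to itself. For $f:A\to B$ and a moment $\phi=ir$ of $A$, the pushforward $f_*(\phi)\in m_B$ is the moment $js$, where $j$ is the inert part of $fi$ and $s$ is the active retraction of $j$. An object $U$ is a \emph{unit} if it has non-identity moments, none of which is centric, and if every active morphism with target $U$ has exactly one inert section. A moment category is \emph{unital} if for each object $A$ there is a pair $(U,\phi)$ of a unit $U$ and an active morphism $\phi:U\to A$, unique up to a unique isomorphism. A moment is \emph{elementary} if it splits over a unit; $\mathrm{el}_A\subseteq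 m_A$ is the set of elementary moments of $A$. For unital moment categories $C,D$, the \emph{wreath product} $C\wr D$ has as objects the tuples $(A,(B_\alpha)_{\alpha\in \mathrm{el}_A})$ with $A$ in $C$ and $B_\alpha$ in $D$, and as morphisms $(A,B_\alpha)\to(A',B'_{\alpha'})$ the tuples consisting of a morphism $f:A\to A'$ in $C$ and of morphisms $f_\alpha^{\alpha'}:B_\alpha\to B'_{\alpha'}$ in $D$, one for each pair $\alpha\in\mathrm{el}_A$, $\alpha'\in \mathrm{el}_{A'}$ with $\alpha'\le f_*(\alpha)$. The component of a composite $gf$ at $(\alpha,\alpha'')$ is $g_{\alpha'}^{\alpha''}f_\alpha^{\alpha'}$ for the unique $\alpha'\in\mathrm{el}_{A'}$ with $\alpha'\le f_*(\alpha)$ and $\alpha''\le g_*(\alpha')$. A morphism of $C\wr D$ is active (inert) if $f$ and all $f_\alpha^{\alpha'}$ are active (inert). \textbf{Proposition.} Let $C$ and $D$ be unital moment categories. (1) $C\wr D$ is a moment category. If $D$ has a unit and any two units of $D$ are isomorphic by exactly one isomorphism, then $C\wr D$ is a unital moment category; if moreover $C$ has a unit and any two units of $C$ are isomorphic by exactly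 one isomorphism, then $C\wr D$ has this property too. (2) The simplex category $\Delta$, with the endpoint-preserving maps as active and the distance-preserving maps ($f(i+1)=f(i)+1$ for all $i$) as inert morphisms, is a unital moment category. Let $\Theta_1=\Delta$, and for $n\ge1$ let $\Theta_{n+1}$ be the category of tuples $([m];T_1,\dots,T_m)$ with $T_i$ in $\Theta_n$, in which a morphism $([m];T_i)\to([m'];T'_j)$ consists of a map $f:[m]\to[m']$ of $\Delta$ and of a morphism $T_i\to T'_j$ whenever $f(i-1)<j\le f(i)$; it is active (inert) if $f$ and all its components are. Then for every $n\ge 1$ Joyal's category $\Theta_n$ is a unital moment category whose unit is unique up to a unique isomorphism, and $\Theta_{n+1}$ is equivalent to $\Delta\wr\Theta_n$ by an equivalence that preserves and reflects active and inert morphisms. -/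

import Mathlib

open CategoryTheory

universe v₁ v₂ u₁ u₂

namespace MomentCat

/-- Two distinguished classes of morphisms, the active and the inert ones. -/
class ActiveInert (C : Type u₁) [Category.{v₁} C] where
  act : ∀ {X Y : C}, (X ⟶ Y) → Prop
  inert : ∀ {X Y : C}, (X ⟶ Y) → Prop

open ActiveInert

/-- A moment category: the active and the inert morphisms form two closed classes (they contain
all isomorphisms and are stable under composition), every morphism factors essentially uniquely as
an active morphism followed by an inert one, and the axioms (M1) and (M2) hold. -/
class IsMomentCategory (C : Type u₁) [Category.{v₁} C] [ActiveInert C] : Prop where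
  act_of_iso : ∀ {X Y : C} (h : X ≅ Y), act h.hom
  inert_of_iso : ∀ {X Y : C} (h : X ≅ Y), inert h.hom
  act_comp : ∀ {X Y Z : C} (f : X ⟶ Y) (g : Y ⟶ Z), act f → act g → act (f ≫ g)
  inert_comp : ∀ {X Y Z : C} (f : X ⟶ Y) (g : Y ⟶ Z), inert f → inert g → inert (f ≫ g)
  exists_fac : ∀ {X Y : C} (f : X ⟶ Y),
    ∃ (Z : C) (a : X ⟶ Z) (i : Z ⟶ Y), act a ∧ inert i ∧ a ≫ i = f
  fac_unique : ∀ {X Y Z Z' : C} (a : X ⟶ Z) (i : Z ⟶ Y) (a' : X ⟶ Z') (i' : Z' ⟶ Y),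
    act a → inert i → act a' → inert i' → a ≫ i = a' ≫ i' →
      ∃! h : Z ≅ Z', a ≫ h.hom = a' ∧ h.hom ≫ i' = i
  /-- (M1): every inert morphism has a unique active retraction. -/
  exists_unique_retraction : ∀ {X Y : C} (i : X ⟶ Y), inert i →
    ∃! r : Y ⟶ X, act r ∧ i ≫ r = 𝟙 X
  /-- (M2): if `f ∘ i = g` with `i` inert and `f`, `g` active, then `f = g ∘ r`, where `r` is the
  active retraction of `i`. -/
  eq_retraction_comp : ∀ {X Y Z : C} (i : X ⟶ Y) (f : Y ⟶ Z) (g : X ⟶ Z) (r : Y ⟶ X),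
    inert i → act f → act g → act r → i ≫ r = 𝟙 X → i ≫ f = g → f = r ≫ g

section Moments

variable {C : Type u₁} [Category.{v₁} C] [ActiveInert C]

/-- A moment of `A` is an endomorphism whose active part is a retraction of its inert part. -/
def IsMoment {A : C} (φ : A ⟶ A) : Prop :=
  ∀ (B : C) (r : A ⟶ B) (i : B ⟶ A), act r → inert i → r ≫ i = φ → i ≫ r = 𝟙 B

/-- The set `m_A` of moments of `A`. -/
def Moment (A : C) : Type v₁ := {φ : A ⟶ A // IsMoment φ}

/-- `φ` is a submoment of `ψ`: one has `ψ ∘ φ = φ`. -/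
def Moment.Sub {A : C} (φ ψ : Moment A) : Prop := φ.1 ≫ ψ.1 = φ.1

/-- Congruence of moments: `φ = φψφ` and `ψ = ψφψ`. -/
def Moment.Congr {A : C} (φ ψ : Moment A) : Prop :=
  φ.1 = φ.1 ≫ ψ.1 ≫ φ.1 ∧ ψ.1 = ψ.1 ≫ φ.1 ≫ ψ.1

/-- A moment is centric if it is the only element of its congruence class. -/
def Moment.Centric {A : C} (φ : Moment A) : Prop := ∀ ψ : Moment A, φ.Congr ψ → ψ = φ

/-- The moment `φ` splits over `B`. -/
def Moment.SplitsOver {A : C} (φ : Moment A) (B : C) : Prop :=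
  ∃ (r : A ⟶ B) (i : B ⟶ A), act r ∧ inert i ∧ r ≫ i = φ.1

/-- `U` is primitive if it has non-identity moments, but none of them is centric. -/
def IsPrimitive (U : C) : Prop :=
  (∃ φ : Moment U, φ.1 ≠ 𝟙 U) ∧ ∀ φ : Moment U, φ.1 ≠ 𝟙 U → ¬ φ.Centric

/-- `U` is a unit if (U1) it is primitive and (U2) each active morphism with target `U` has one
and only one inert section. -/
def IsUnitObj (U : C) : Prop :=
  IsPrimitive U ∧ ∀ (X : C) (f : X ⟶ U), act f → ∃! i : U ⟶ X, inert i ∧ i ≫ f = 𝟙 U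

/-- A moment is elementary if it splits over a unit. -/
def Moment.IsElementary {A : C} (φ : Moment A) : Prop := ∃ U : C, IsUnitObj U ∧ φ.SplitsOver U

/-- The set `el_A` of elementary moments of `A`. -/
def El (A : C) : Type v₁ := {φ : Moment A // φ.IsElementary}

end Moments

/-- A moment category is unital if for each object `A` there is an essentially unique pair
consisting of a unit `U` and an active morphism `U ⟶ A`. -/
class IsUnital (C : Type u₁) [Category.{v₁} C] [ActiveInert C] : Prop
    extends IsMomentCategory C where
  exists_unit : ∀ A : C, ∃ (U : C) (φ : U ⟶ A), IsUnitObj U ∧ act φ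
  unit_unique : ∀ {A U U' : C} (φ : U ⟶ A) (φ' : U' ⟶ A), IsUnitObj U → IsUnitObj U' →
    act φ → act φ' → ∃! h : U ≅ U', h.hom ≫ φ' = φ

/-- There is a unit, and it is unique up to unique isomorphism. -/
def HasEssentiallyUniqueUnit (C : Type u₁) [Category.{v₁} C] [ActiveInert C] : Prop :=
  (∃ U : C, IsUnitObj U) ∧
    ∀ U U' : C, IsUnitObj U → IsUnitObj U' → Nonempty (Unique (U ≅ U'))

/-! Basic facts about moment categories, needed to define the pushforward of moments. -/

section Basic

variable {C : Type u₁} [Category.{v₁} C] [ActiveInert C] [IsMomentCategory C]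

open IsMomentCategory

lemma act_id (X : C) : act (𝟙 X) := act_of_iso (Iso.refl X)

lemma inert_id (X : C) : inert (𝟙 X) := inert_of_iso (Iso.refl X)

lemma isMoment_of_retraction {A B : C} {r : A ⟶ B} {i : B ⟶ A} (hr : act r) (hi : inert i)
    (h : i ≫ r = 𝟙 B) : IsMoment (r ≫ i) := by
  intro B' r' i' hr' hi' e
  obtain ⟨k, ⟨h1, h2⟩, -⟩ := fac_unique r i r' i' hr hi hr' hi' e.symm
  have e1 : i' = k.inv ≫ i := by simp [← h2]
  rw [e1, ← h1, Category.assoc, reassoc_of% h]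
  simp

/-- If `a` and `a ≫ b` are active, so is `b`. -/
lemma act_of_act_comp {X Y Z : C} {a : X ⟶ Y} {b : Y ⟶ Z} (ha : act a) (hab : act (a ≫ b)) :
    act b := by
  obtain ⟨W, p, q, hp, hq, rfl⟩ := exists_fac b
  obtain ⟨k, ⟨-, h2⟩, -⟩ := fac_unique (a ≫ p) q (a ≫ p ≫ q) (𝟙 Z) (act_comp _ _ ha hp) hq hab
    (inert_id Z) (by simp)
  have hq' : q = k.hom := by simpa using h2.symm
  rw [hq']
  exact act_comp _ _ hp (act_of_iso k)

/-- If `i` and `k ≫ i` are inert, so is `k`. -/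
lemma inert_of_comp_inert {X Y Z : C} {k : X ⟶ Y} {i : Y ⟶ Z} (hi : inert i)
    (hki : inert (k ≫ i)) : inert k := by
  obtain ⟨W, p, q, hp, hq, rfl⟩ := exists_fac k
  obtain ⟨e, ⟨h1, -⟩, -⟩ := fac_unique (𝟙 X) ((p ≫ q) ≫ i) p (q ≫ i) (act_id X) hki hp
    (inert_comp _ _ hq hi) (by simp)
  have hp' : p = e.hom := by simpa using h1.symm
  rw [hp']
  exact inert_comp _ _ (inert_of_iso e) hq

lemma retraction_unique {X Y : C} {i : X ⟶ Y} (hi : inert i) {r s : Y ⟶ X} (hr : act r)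
    (hs : act s) (h : i ≫ r = 𝟙 X) (h' : i ≫ s = 𝟙 X) : r = s :=
  (exists_unique_retraction i hi).unique ⟨hr, h⟩ ⟨hs, h'⟩

lemma section_unique {U X : C} (hU : IsUnitObj U) {f : X ⟶ U} (hf : act f) {i j : U ⟶ X}
    (hi : inert i) (hj : inert j) (h : i ≫ f = 𝟙 U) (h' : j ≫ f = 𝟙 U) : i = j :=
  (hU.2 X f hf).unique ⟨hi, h⟩ ⟨hj, h'⟩

lemma Moment.exists_split {A : C} (φ : Moment A) :
    ∃ (B : C) (r : A ⟶ B) (i : B ⟶ A), act r ∧ inert i ∧ i ≫ r = 𝟙 B ∧ r ≫ i = φ.1 := by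
  obtain ⟨B, r, i, hr, hi, e⟩ := exists_fac φ.1
  exact ⟨B, r, i, hr, hi, φ.2 B r i hr hi e, e⟩

/-- The data entering into the definition of the pushforward of `φ` along `f`: a splitting of `φ`,
an active/inert factorisation of `f ∘ φ_in`, and the active retraction of its inert part. -/
lemma exists_pushforward {A B : C} (f : A ⟶ B) (φ : Moment A) :
    ∃ ψ : Moment B, ∃ (A' B' : C) (r : A ⟶ A') (i : A' ⟶ A) (f' : A' ⟶ B') (j : B' ⟶ B)
      (s : B ⟶ B'), act r ∧ inert i ∧ r ≫ i = φ.1 ∧ act f' ∧ inert j ∧ f' ≫ j = i ≫ f ∧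
      act s ∧ j ≫ s = 𝟙 B' ∧ s ≫ j = ψ.1 := by
  obtain ⟨A', r, i, hr, hi, -, e⟩ := φ.exists_split
  obtain ⟨B', f', j, hf', hj, e'⟩ := exists_fac (i ≫ f)
  obtain ⟨s, ⟨hs, hs'⟩, -⟩ := exists_unique_retraction j hj
  exact ⟨⟨s ≫ j, isMoment_of_retraction hs hj hs'⟩, A', B', r, i, f', j, s, hr, hi, e, hf', hj, e',
    hs, hs', rfl⟩

/-- The pushforward `f_*(φ)` of a moment `φ` of `A` along `f : A ⟶ B`; by `push_eq` it does not
depend on the choices made. -/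
noncomputable def push {A B : C} (f : A ⟶ B) (φ : Moment A) : Moment B :=
  (exists_pushforward f φ).choose

lemma push_eq {A B A' B' : C} (f : A ⟶ B) (φ : Moment A) {r : A ⟶ A'} {i : A' ⟶ A}
    {f' : A' ⟶ B'} {j : B' ⟶ B} {s : B ⟶ B'} (hr : act r) (hi : inert i) (e : r ≫ i = φ.1)
    (hf' : act f') (hj : inert j) (e' : f' ≫ j = i ≫ f) (hs : act s) (hs' : j ≫ s = 𝟙 B') :
    (push f φ).1 = s ≫ j := by
  obtain ⟨A₁, B₁, r₁, i₁, f₁, j₁, s₁, hr₁, hi₁, e₁, hf₁, hj₁, e₁', hs₁, hs₁', e₂⟩ :=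
    (exists_pushforward f φ).choose_spec
  change s₁ ≫ j₁ = (push f φ).1 at e₂
  rw [← e₂]
  obtain ⟨h, ⟨-, h2⟩, -⟩ := fac_unique r₁ i₁ r i hr₁ hi₁ hr hi (e₁.trans e.symm)
  obtain ⟨k, ⟨-, k2⟩, -⟩ := fac_unique f₁ j₁ (h.hom ≫ f') j hf₁ hj₁
    (act_comp _ _ (act_of_iso h) hf') hj (by rw [e₁', Category.assoc, e', reassoc_of% h2])
  have : s₁ = s ≫ k.inv := by
    refine retraction_unique hj₁ hs₁ (act_comp _ _ hs (act_of_iso k.symm)) hs₁' ?_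
    rw [← k2, Category.assoc, reassoc_of% hs']
    simp
  rw [this, ← k2]
  simp

/-- If `j` is the inert part of `f ∘ i`, then the active retractions form a commutative square. -/
lemma retraction_square {A B A' B' : C} {f : A ⟶ B} {r : A ⟶ A'} {i : A' ⟶ A}
    {f' : A' ⟶ B'} {j : B' ⟶ B} {s : B ⟶ B'} (hr : act r) (hi : inert i) (hir : i ≫ r = 𝟙 A')
    (hf' : act f') (hj : inert j) (e' : f' ≫ j = i ≫ f) (hs : act s) (hs' : j ≫ s = 𝟙 B') :
    f ≫ s = r ≫ f' := by
  obtain ⟨E, a, b, ha, hb, rfl⟩ := exists_fac f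
  obtain ⟨F, p, c, hp, hc, hpc⟩ := exists_fac (i ≫ a)
  obtain ⟨k, ⟨-, k2⟩, -⟩ := fac_unique f' j p (c ≫ b) hf' hj hp (inert_comp _ _ hc hb)
    (by rw [e', reassoc_of% hpc])
  obtain ⟨b', ⟨hb', hbb'⟩, -⟩ := exists_unique_retraction b hb
  obtain ⟨c', ⟨hc', hcc'⟩, -⟩ := exists_unique_retraction c hc
  have : s = b' ≫ c' ≫ k.inv := by
    refine retraction_unique hj hs
      (act_comp _ _ hb' (act_comp _ _ hc' (act_of_iso k.symm))) hs' ?_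
    rw [← k2]
    simp only [Category.assoc]
    rw [reassoc_of% hbb', reassoc_of% hcc', Iso.hom_inv_id]
  have hact : act ((a ≫ b) ≫ s) := by
    rw [this]
    simp only [Category.assoc]
    rw [reassoc_of% hbb']
    exact act_comp _ _ ha (act_comp _ _ hc' (act_of_iso k.symm))
  refine eq_retraction_comp i _ f' r hi hact hf' hr hir ?_
  rw [← Category.assoc, ← e', Category.assoc, hs', Category.comp_id]

lemma push_id {A : C} (φ : Moment A) : push (𝟙 A) φ = φ := by
  obtain ⟨B, r, i, hr, hi, hir, e⟩ := φ.exists_split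
  refine Subtype.ext ?_
  rw [push_eq (𝟙 A) φ hr hi e (act_id B) hi (by simp) hr hir, e]

lemma push_comp {A B D : C} (f : A ⟶ B) (g : B ⟶ D) (φ : Moment A) :
    push (f ≫ g) φ = push g (push f φ) := by
  obtain ⟨A', r, i, hr, hi, hir, e⟩ := φ.exists_split
  obtain ⟨B', f', j, hf', hj, e'⟩ := exists_fac (i ≫ f)
  obtain ⟨s, ⟨hs, hs'⟩, -⟩ := exists_unique_retraction j hj
  obtain ⟨D', g', k, hg', hk, e''⟩ := exists_fac (j ≫ g)
  obtain ⟨t, ⟨ht, ht'⟩, -⟩ := exists_unique_retraction k hk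
  refine Subtype.ext ?_
  rw [push_eq (f ≫ g) φ hr hi e (act_comp _ _ hf' hg') hk
      (by rw [Category.assoc, e'', reassoc_of% e']) ht ht',
    push_eq g (push f φ) hs hj (push_eq f φ hr hi e hf' hj e' hs hs').symm hg' hk e'' ht ht']

lemma El.exists_split {A : C} (α : El A) :
    ∃ (U : C) (r : A ⟶ U) (i : U ⟶ A), IsUnitObj U ∧ act r ∧ inert i ∧ i ≫ r = 𝟙 U ∧
      r ≫ i = α.1.1 := by
  obtain ⟨U, hU, r, i, hr, hi, e⟩ := α.2
  exact ⟨U, r, i, hU, hr, hi, α.1.2 U r i hr hi e, e⟩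

/-- A moment whose active part has only one inert section is centric. -/
lemma centric_of_section_unique {A B : C} {r : A ⟶ B} {i : B ⟶ A} (hr : act r) (hi : inert i)
    (hir : i ≫ r = 𝟙 B) (h : ∀ j : B ⟶ A, inert j → j ≫ r = 𝟙 B → j = i) :
    Moment.Centric (⟨r ≫ i, isMoment_of_retraction hr hi hir⟩ : Moment A) := by
  intro ψ hψ
  obtain ⟨B', s, j, hs, hj, hjs, e⟩ := ψ.exists_split
  obtain ⟨h1, h2⟩ := hψ
  dsimp only at h1 h2
  rw [← e] at h1 h2
  have k1 : i ≫ s ≫ j ≫ r = 𝟙 B := by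
    have := congrArg (fun t => i ≫ t ≫ r) h1
    simp only [Category.assoc, hir, reassoc_of% hir, Category.comp_id] at this
    exact this.symm
  have k2 : j ≫ r ≫ i ≫ s = 𝟙 B' := by
    have := congrArg (fun t => j ≫ t ≫ s) h2
    simp only [Category.assoc, hjs, reassoc_of% hjs, Category.comp_id] at this
    exact this.symm
  let w : B ≅ B' := ⟨i ≫ s, j ≫ r, by simpa using k1, by simpa using k2⟩
  have hji : w.hom ≫ j = i := by
    refine h _ (inert_comp _ _ (inert_of_iso w) hj) ?_
    simpa [w] using k1
  have hs2 : s = r ≫ w.hom := by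
    refine retraction_unique hj hs (act_comp _ _ hr (act_of_iso w)) hjs ?_
    simpa [w] using k2
  refine Subtype.ext ?_
  change ψ.1 = r ≫ i
  rw [← e, hs2, Category.assoc, hji]

/-- Active morphisms between units are invertible. -/
lemma exists_iso_of_act {U V : C} (hU : IsUnitObj U) (hV : IsUnitObj V) {f : U ⟶ V}
    (hf : act f) : ∃ h : U ≅ V, h.hom = f := by
  obtain ⟨i, ⟨hi, hif⟩, huniq⟩ := hV.2 U f hf
  have hc := centric_of_section_unique hf hi hif (fun j hj hj' => huniq j ⟨hj, hj'⟩)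
  have : f ≫ i = 𝟙 U := by
    by_contra hne
    exact hU.1.2 _ hne hc
  exact ⟨⟨f, i, this, hif⟩, rfl⟩

/-- For each elementary moment `γ` of the target of `g` there is at most one elementary moment `β`
of the source with `γ ≤ g_*(β)`. -/
lemma El.eq_of_sub_push {B D : C} (g : B ⟶ D) (γ : El D) (β₁ β₂ : El B)
    (h₁ : γ.1.Sub (push g β₁.1)) (h₂ : γ.1.Sub (push g β₂.1)) : β₁ = β₂ := by
  obtain ⟨W, s, j, hW, hs, hj, hjs, e⟩ := γ.exists_split
  have key : ∀ β : El B, γ.1.Sub (push g β.1) →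
      ∃ l : W ⟶ B, inert l ∧ act (g ≫ s) ∧ l ≫ g ≫ s = 𝟙 W ∧ (g ≫ s) ≫ l = β.1.1 := by
    intro β hβ
    obtain ⟨U, r, i, hU, hr, hi, hir, e'⟩ := β.exists_split
    obtain ⟨D', g', k, hg', hk, e''⟩ := exists_fac (i ≫ g)
    obtain ⟨t, ⟨ht, ht'⟩, -⟩ := exists_unique_retraction k hk
    unfold Moment.Sub at hβ
    rw [push_eq g β.1 hr hi e' hg' hk e'' ht ht', ← e] at hβ
    have hj' : (j ≫ t) ≫ k = j := by
      have := congrArg (fun x => j ≫ x) hβ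
      simp only [Category.assoc, reassoc_of% hjs] at this
      simpa using this
    have hin : inert (j ≫ t) := inert_of_comp_inert hk (hj'.symm ▸ hj)
    obtain ⟨q, ⟨hq, hq'⟩, -⟩ := exists_unique_retraction (j ≫ t) hin
    have hstq : s = t ≫ q := by
      refine retraction_unique hj hs (act_comp _ _ ht hq) hjs ?_
      simpa using hq'
    have sq := retraction_square hr hi hir hg' hk e'' ht ht'
    obtain ⟨w, hw⟩ := exists_iso_of_act hU hW (act_comp _ _ hg' hq)
    have hgs : g ≫ s = r ≫ w.hom := by
      rw [hstq, ← Category.assoc, sq, Category.assoc, hw]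
    refine ⟨w.inv ≫ i, inert_comp _ _ (inert_of_iso w.symm) hi, ?_, ?_, ?_⟩
    · rw [hgs]
      exact act_comp _ _ hr (act_of_iso w)
    · rw [hgs, Category.assoc, reassoc_of% hir, w.inv_hom_id]
    · rw [hgs, Category.assoc, w.hom_inv_id_assoc, e']
  obtain ⟨l₁, hl₁, ha, hs₁, e₁⟩ := key β₁ h₁
  obtain ⟨l₂, hl₂, -, hs₂, e₂⟩ := key β₂ h₂
  have : l₁ = l₂ := section_unique hW ha hl₁ hl₂ hs₁ hs₂
  refine Subtype.ext (Subtype.ext ?_)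
  rw [← e₁, ← e₂, this]

/-- If `γ ≤ (gf)_*(α)` then there is an elementary moment `β ≤ f_*(α)` with `γ ≤ g_*(β)`. -/
lemma El.exists_mid {A B D : C} (f : A ⟶ B) (g : B ⟶ D) (α : El A) (γ : El D)
    (h : γ.1.Sub (push (f ≫ g) α.1)) :
    ∃ β : El B, β.1.Sub (push f α.1) ∧ γ.1.Sub (push g β.1) := by
  obtain ⟨W, s, j, hW, hs, hj, hjs, e⟩ := γ.exists_split
  obtain ⟨U, r, i, hU, hr, hi, hir, e'⟩ := α.exists_split
  obtain ⟨B', f', i', hf', hi', ef⟩ := exists_fac (i ≫ f)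
  obtain ⟨r', ⟨hr', hir'⟩, -⟩ := exists_unique_retraction i' hi'
  obtain ⟨D', g', k, hg', hk, eg⟩ := exists_fac (i' ≫ g)
  obtain ⟨t, ⟨ht, ht'⟩, -⟩ := exists_unique_retraction k hk
  unfold Moment.Sub at h
  rw [push_eq (f ≫ g) α.1 hr hi e' (act_comp _ _ hf' hg') hk
      (by rw [Category.assoc, eg, reassoc_of% ef]) ht ht', ← e] at h
  have hj' : (j ≫ t) ≫ k = j := by
    have := congrArg (fun x => j ≫ x) h
    simp only [Category.assoc, reassoc_of% hjs] at this
    simpa using this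
  have hin : inert (j ≫ t) := inert_of_comp_inert hk (hj'.symm ▸ hj)
  obtain ⟨q, ⟨hq, hq'⟩, -⟩ := exists_unique_retraction (j ≫ t) hin
  obtain ⟨l, ⟨hl, hl'⟩, -⟩ := hW.2 B' (g' ≫ q) (act_comp _ _ hg' hq)
  have hli : inert (l ≫ i') := inert_comp _ _ hl hi'
  obtain ⟨p, ⟨hp, hp'⟩, -⟩ := exists_unique_retraction (l ≫ i') hli
  let β : El B := ⟨⟨p ≫ l ≫ i', isMoment_of_retraction hp hli hp'⟩, W, hW, p, l ≫ i', hp, hli, rfl⟩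
  refine ⟨β, ?_, ?_⟩
  · unfold Moment.Sub
    rw [push_eq f α.1 hr hi e' hf' hi' ef hr' hir']
    change (p ≫ l ≫ i') ≫ r' ≫ i' = p ≫ l ≫ i'
    simp only [Category.assoc]
    rw [reassoc_of% hir']
  · obtain ⟨E, a, b, ha, hb, eab⟩ := exists_fac (l ≫ g')
    have hbk : inert (b ≫ k) := inert_comp _ _ hb hk
    obtain ⟨z, ⟨hz, hz'⟩, -⟩ := exists_unique_retraction (b ≫ k) hbk
    have habq : a ≫ b ≫ q = 𝟙 W := by rw [reassoc_of% eab]; exact hl'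
    have hbq : act (b ≫ q) := act_of_act_comp ha (by rw [habq]; exact act_id W)
    obtain ⟨c, ⟨hc, hc'⟩, -⟩ := hW.2 E (b ≫ q) hbq
    have hcb : c ≫ b = j ≫ t :=
      section_unique hW hq (inert_comp _ _ hc hb) hin (by simpa using hc') hq'
    unfold Moment.Sub
    rw [push_eq g β.1 hp hli rfl ha hbk (by simp only [Category.assoc]; rw [reassoc_of% eab, eg])
      hz hz', ← e]
    have : j = c ≫ b ≫ k := by rw [reassoc_of% hcb]; simpa using hj'.symm
    rw [Category.assoc]
    congr 1
    rw [this]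
    simp only [Category.assoc] at hz' ⊢
    rw [reassoc_of% hz']

lemma El.sub_push_id {A : C} (α : El A) : α.1.Sub (push (𝟙 A) α.1) := by
  rw [push_id]
  obtain ⟨U, r, i, -, -, -, hir, e⟩ := α.exists_split
  unfold Moment.Sub
  rw [← e, Category.assoc, reassoc_of% hir]

lemma El.eq_of_sub_push_id {A : C} {α α' : El A} (h : α'.1.Sub (push (𝟙 A) α.1)) : α = α' :=
  El.eq_of_sub_push (𝟙 A) α' α α' h α'.sub_push_id

lemma Moment.Sub.trans_push {A B : C} (f : A ⟶ B) {φ ψ : Moment A} (h : φ.Sub ψ) :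
    (push f φ).Sub (push f ψ) := by
  obtain ⟨A₁, r, i, hr, hi, hir, e⟩ := φ.exists_split
  obtain ⟨A₂, s, j, hs, hj, hjs, e'⟩ := ψ.exists_split
  obtain ⟨B₂, f₂, k, hf₂, hk, ek⟩ := exists_fac (j ≫ f)
  obtain ⟨t, ⟨ht, ht'⟩, -⟩ := exists_unique_retraction k hk
  unfold Moment.Sub at h
  rw [← e, ← e'] at h
  have hij : (i ≫ s) ≫ j = i := by
    have := congrArg (fun x => i ≫ x) h
    simp only [Category.assoc, reassoc_of% hir] at this
    simpa using this
  obtain ⟨B₁, f₁, l, hf₁, hl, el⟩ := exists_fac ((i ≫ s) ≫ f₂)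
  obtain ⟨z, ⟨hz, hz'⟩, -⟩ := exists_unique_retraction (l ≫ k) (inert_comp _ _ hl hk)
  unfold Moment.Sub
  rw [push_eq f φ hr hi e hf₁ (inert_comp _ _ hl hk)
    (by rw [reassoc_of% el, ek, ← Category.assoc, ← Category.assoc, hij]) hz hz',
    push_eq f ψ hs hj e' hf₂ hk ek ht ht']
  simp only [Category.assoc]
  rw [reassoc_of% ht']

lemma Moment.Sub.trans {A : C} {φ ψ χ : Moment A} (h : φ.Sub ψ) (h' : ψ.Sub χ) : φ.Sub χ := by
  unfold Moment.Sub at *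
  rw [← h, Category.assoc, h']

lemma El.sub_push_comp {A B D : C} {f : A ⟶ B} {g : B ⟶ D} {α : El A} {β : El B} {γ : El D}
    (h : β.1.Sub (push f α.1)) (h' : γ.1.Sub (push g β.1)) :
    γ.1.Sub (push (f ≫ g) α.1) := by
  rw [push_comp]
  exact h'.trans (h.trans_push g)

end Basic

/-! The wreath product. -/

section Wreath

/-- An object `(A, B_α)` of the wreath product: an object `A` of `C` and a family of objects of `D`
indexed by the elementary moments of `A`. -/
structure Wreath (C : Type u₁) [Category.{v₁} C] [ActiveInert C] (D : Type u₂) :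
    Type (max u₁ v₁ u₂) where
  base : C
  fam : El base → D

variable {C : Type u₁} [Category.{v₁} C] [ActiveInert C] [IsMomentCategory C]
  {D : Type u₂} [Category.{v₂} D]

/-- A morphism of the wreath product: a morphism `f : A ⟶ A'` and morphisms `B_α ⟶ B'_α'` whenever
`α' ≤ f_*(α)`. -/
@[ext]
structure Wreath.Hom (X Y : Wreath C D) : Type (max v₁ v₂) where
  base : X.base ⟶ Y.base
  app : ∀ (α : El X.base) (α' : El Y.base), α'.1.Sub (push base α.1) → (X.fam α ⟶ Y.fam α')

/-- Identities: the components are the identities of the `B_α`; indeed `α' ≤ α` implies `α' = α`. -/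
def Wreath.Hom.id (X : Wreath C D) : Wreath.Hom X X where
  base := 𝟙 X.base
  app _ _ h := eqToHom (congrArg X.fam (El.eq_of_sub_push_id h))

/-- Composition: the component at `α'' ≤ (gf)_*(α)` is the composite of the components of `f` at
`(α, α')` and of `g` at `(α', α'')` for the unique `α' ≤ f_*(α)` with `α'' ≤ g_*(α')`. -/
noncomputable def Wreath.Hom.comp {X Y Z : Wreath C D} (f : Wreath.Hom X Y) (g : Wreath.Hom Y Z) :
    Wreath.Hom X Z where
  base := f.base ≫ g.base
  app α α'' h :=
    f.app α _ (El.exists_mid f.base g.base α α'' h).choose_spec.1 ≫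
      g.app _ α'' (El.exists_mid f.base g.base α α'' h).choose_spec.2

lemma Wreath.Hom.comp_app {X Y Z : Wreath C D} (f : Wreath.Hom X Y) (g : Wreath.Hom Y Z)
    (α : El X.base) (β : El Y.base) (γ : El Z.base) (h₁ : β.1.Sub (push f.base α.1))
    (h₂ : γ.1.Sub (push g.base β.1)) (h : γ.1.Sub (push (f.base ≫ g.base) α.1)) :
    (Wreath.Hom.comp f g).app α γ h = f.app α β h₁ ≫ g.app β γ h₂ := by
  have hs := (El.exists_mid f.base g.base α γ h).choose_spec
  have e : β = (El.exists_mid f.base g.base α γ h).choose :=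
    El.eq_of_sub_push g.base γ _ _ h₂ hs.2
  subst e
  rfl

lemma Wreath.Hom.ext' {X Y : Wreath C D} (f g : Wreath.Hom X Y) (hb : f.base = g.base)
    (ha : ∀ α α' h h', f.app α α' h = g.app α α' h') : f = g := by
  obtain ⟨fb, fa⟩ := f
  obtain ⟨gb, ga⟩ := g
  dsimp only at hb
  subst hb
  congr 1
  funext α α' h
  exact ha α α' h h

noncomputable instance Wreath.instCategory : Category.{max v₁ v₂} (Wreath C D) where
  Hom := Wreath.Hom
  id := Wreath.Hom.id
  comp := Wreath.Hom.comp
  id_comp {X Y} f := by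
    refine Wreath.Hom.ext' _ _ (Category.id_comp _) fun α α' h h' => ?_
    rw [Wreath.Hom.comp_app (Wreath.Hom.id X) f α α α' α.sub_push_id h' h]
    exact Category.id_comp _
  comp_id {X Y} f := by
    refine Wreath.Hom.ext' _ _ (Category.comp_id _) fun α α' h h' => ?_
    rw [Wreath.Hom.comp_app f (Wreath.Hom.id Y) α α' α' h' α'.sub_push_id h]
    exact Category.comp_id _
  assoc {W X Y Z} f g k := by
    refine Wreath.Hom.ext' _ _ (Category.assoc _ _ _) fun α δ h h' => ?_
    obtain ⟨γ, hγ, hδ⟩ := El.exists_mid (f.base ≫ g.base) k.base α δ h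
    obtain ⟨β, hβ, hγ'⟩ := El.exists_mid f.base g.base α γ hγ
    rw [Wreath.Hom.comp_app (Wreath.Hom.comp f g) k α γ δ hγ hδ h,
      Wreath.Hom.comp_app f g α β γ hβ hγ' hγ,
      Wreath.Hom.comp_app f (Wreath.Hom.comp g k) α β δ hβ (El.sub_push_comp hγ' hδ) h',
      Wreath.Hom.comp_app g k β γ δ hγ' hδ, Category.assoc]

/-- A morphism of the wreath product is active (inert) if its base and all its components are. -/
instance Wreath.instActiveInert [ActiveInert D] : ActiveInert (Wreath C D) where
  act {X Y} (f : Wreath.Hom X Y) := act f.base ∧ ∀ α α' h, act (f.app α α' h)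
  inert {X Y} (f : Wreath.Hom X Y) := inert f.base ∧ ∀ α α' h, inert (f.app α α' h)

end Wreath

/-! The simplex category and Joyal's categories `Θ_n`. -/

section Theta

/-- A simplicial operator is active if it preserves endpoints, and inert if it preserves
distances. -/
instance : ActiveInert SimplexCategory where
  act {X Y} f := f.toOrderHom 0 = 0 ∧ f.toOrderHom (Fin.last X.len) = Fin.last Y.len
  inert {X _} f :=
    ∀ i : Fin X.len, (f.toOrderHom i.succ : ℕ) = (f.toOrderHom i.castSucc : ℕ) + 1

/-- Objects of the classical wreath product of the simplex category with `D`: tuples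
`([m]; B_1, …, B_m)`. -/
structure DeltaWreath (D : Type u₂) : Type u₂ where
  base : SimplexCategory
  fam : Fin base.len → D

/-- For `f : [m] ⟶ [n]`, the segment `j` of `[n]` lies in the interval spanned by the image of the
segment `i` of `[m]`. Segments are indexed from `0`: the segment `i` has endpoints `i`, `i + 1`. -/
def Covers {X Y : SimplexCategory} (f : X ⟶ Y) (i : Fin X.len) (j : Fin Y.len) : Prop :=
  f.toOrderHom i.castSucc ≤ j.castSucc ∧ j.succ ≤ f.toOrderHom i.succ

lemma Covers.eq {X Y : SimplexCategory} {f : X ⟶ Y} {i i' : Fin X.len} {j : Fin Y.len}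
    (h : Covers f i j) (h' : Covers f i' j) : i = i' := by
  by_contra hne
  rcases lt_or_gt_of_ne hne with hlt | hlt
  · have h1 := f.toOrderHom.monotone (show i.succ ≤ i'.castSucc from hlt)
    exact absurd (h.2.trans (h1.trans h'.1)) (by simp [Fin.le_def])
  · have h1 := f.toOrderHom.monotone (show i'.succ ≤ i.castSucc from hlt)
    exact absurd (h'.2.trans (h1.trans h.1)) (by simp [Fin.le_def])

lemma covers_id {X : SimplexCategory} (i : Fin X.len) : Covers (𝟙 X) i i :=
  ⟨le_refl _, le_refl _⟩

lemma Covers.comp {X Y Z : SimplexCategory} {f : X ⟶ Y} {g : Y ⟶ Z} {i : Fin X.len}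
    {j : Fin Y.len} {k : Fin Z.len} (h : Covers f i j) (h' : Covers g j k) :
    Covers (f ≫ g) i k :=
  ⟨(g.toOrderHom.monotone h.1).trans h'.1, h'.2.trans (g.toOrderHom.monotone h.2)⟩

lemma Covers.exists_mid {X Y Z : SimplexCategory} {f : X ⟶ Y} {g : Y ⟶ Z} {i : Fin X.len}
    {k : Fin Z.len} (h : Covers (f ≫ g) i k) : ∃ j : Fin Y.len, Covers f i j ∧ Covers g j k := by
  have h1 : g.toOrderHom (f.toOrderHom i.castSucc) ≤ k.castSucc := h.1
  have h2 : k.succ ≤ g.toOrderHom (f.toOrderHom i.succ) := h.2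
  classical
  have key : ∀ n : ℕ, ∀ hn : n < Y.len + 1, (f.toOrderHom i.castSucc : ℕ) ≤ n →
      k.succ ≤ g.toOrderHom ⟨n, hn⟩ →
      ∃ j : Fin Y.len, f.toOrderHom i.castSucc ≤ j.castSucc ∧ (j : ℕ) < n ∧ Covers g j k := by
    intro n
    induction n with
    | zero =>
      intro hn hle hk
      have : f.toOrderHom i.castSucc = ⟨0, hn⟩ := Fin.ext (by simpa using hle)
      rw [this] at h1
      exact absurd (hk.trans h1) (by simp [Fin.le_def])
    | succ n ih =>
      intro hn hle hk
      rcases Nat.lt_or_ge n (f.toOrderHom i.castSucc : ℕ) with hlt | hge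
      · have : f.toOrderHom i.castSucc = ⟨n + 1, hn⟩ := Fin.ext (by simp only; omega)
        rw [this] at h1
        exact absurd (hk.trans h1) (by simp [Fin.le_def])
      · by_cases hc : k.succ ≤ g.toOrderHom ⟨n, by omega⟩
        · obtain ⟨j, hj1, hj2, hj3⟩ := ih (by omega) hge hc
          exact ⟨j, hj1, by omega, hj3⟩
        · refine ⟨⟨n, by omega⟩, hge, by simp, ?_, hk⟩
          rw [not_le] at hc
          exact Fin.le_def.2 (Nat.lt_succ_iff.1 (by simpa using Fin.lt_def.1 hc))
  obtain ⟨j, hj1, hj2, hj3⟩ := key (f.toOrderHom i.succ : ℕ) (f.toOrderHom i.succ).2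
    (f.toOrderHom.monotone (Fin.castSucc_lt_succ).le) h2
  exact ⟨j, ⟨hj1, hj2⟩, hj3⟩

variable {D : Type u₂} [Category.{v₂} D]

/-- A morphism `([m]; B_i) ⟶ ([n]; B'_j)`: a simplicial operator `f : [m] ⟶ [n]` and morphisms
`B_i ⟶ B'_j` whenever the segment `j` lies in the image interval of the segment `i`. -/
structure DeltaWreath.Hom (X Y : DeltaWreath D) : Type v₂ where
  base : X.base ⟶ Y.base
  app : ∀ (i : Fin X.base.len) (j : Fin Y.base.len), Covers base i j → (X.fam i ⟶ Y.fam j)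

def DeltaWreath.Hom.id (X : DeltaWreath D) : DeltaWreath.Hom X X where
  base := 𝟙 X.base
  app _ j h := eqToHom (congrArg X.fam (h.eq (covers_id j)))

noncomputable def DeltaWreath.Hom.comp {X Y Z : DeltaWreath D} (f : DeltaWreath.Hom X Y)
    (g : DeltaWreath.Hom Y Z) : DeltaWreath.Hom X Z where
  base := f.base ≫ g.base
  app i k h := f.app i _ h.exists_mid.choose_spec.1 ≫ g.app _ k h.exists_mid.choose_spec.2

lemma DeltaWreath.Hom.comp_app {X Y Z : DeltaWreath D} (f : DeltaWreath.Hom X Y)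
    (g : DeltaWreath.Hom Y Z) (i : Fin X.base.len) (j : Fin Y.base.len) (k : Fin Z.base.len)
    (h₁ : Covers f.base i j) (h₂ : Covers g.base j k) (h : Covers (f.base ≫ g.base) i k) :
    (DeltaWreath.Hom.comp f g).app i k h = f.app i j h₁ ≫ g.app j k h₂ := by
  have e : j = h.exists_mid.choose := h₂.eq h.exists_mid.choose_spec.2
  subst e
  rfl

lemma DeltaWreath.Hom.ext' {X Y : DeltaWreath D} (f g : DeltaWreath.Hom X Y)
    (hb : f.base = g.base) (ha : ∀ i j h h', f.app i j h = g.app i j h') : f = g := by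
  obtain ⟨fb, fa⟩ := f
  obtain ⟨gb, ga⟩ := g
  dsimp only at hb
  subst hb
  congr 1
  funext i j h
  exact ha i j h h

noncomputable instance DeltaWreath.instCategory : Category.{v₂} (DeltaWreath D) where
  Hom := DeltaWreath.Hom
  id := DeltaWreath.Hom.id
  comp := DeltaWreath.Hom.comp
  id_comp {X Y} f := by
    refine DeltaWreath.Hom.ext' _ _ (Category.id_comp _) fun i j h h' => ?_
    rw [DeltaWreath.Hom.comp_app (DeltaWreath.Hom.id X) f i i j (covers_id i) h' h]
    exact Category.id_comp _
  comp_id {X Y} f := by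
    refine DeltaWreath.Hom.ext' _ _ (Category.comp_id _) fun i j h h' => ?_
    rw [DeltaWreath.Hom.comp_app f (DeltaWreath.Hom.id Y) i j j h' (covers_id j) h]
    exact Category.comp_id _
  assoc {W X Y Z} f g k := by
    refine DeltaWreath.Hom.ext' _ _ (Category.assoc _ _ _) fun i l h h' => ?_
    obtain ⟨c, hc, hl⟩ := Covers.exists_mid (f := f.base ≫ g.base) (g := k.base) h
    obtain ⟨b, hb, hc'⟩ := hc.exists_mid
    rw [DeltaWreath.Hom.comp_app (DeltaWreath.Hom.comp f g) k i c l hc hl h,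
      DeltaWreath.Hom.comp_app f g i b c hb hc' hc,
      DeltaWreath.Hom.comp_app f (DeltaWreath.Hom.comp g k) i b l hb (hc'.comp hl) h',
      DeltaWreath.Hom.comp_app g k b c l hc' hl, Category.assoc]

/-- A morphism is active (inert) if its base and all its components are. -/
instance DeltaWreath.instActiveInert [ActiveInert D] : ActiveInert (DeltaWreath D) where
  act {X Y} (f : DeltaWreath.Hom X Y) := act f.base ∧ ∀ i j h, act (f.app i j h)
  inert {X Y} (f : DeltaWreath.Hom X Y) := inert f.base ∧ ∀ i j h, inert (f.app i j h)

/-- A small category together with its classes of active and inert morphisms. -/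
structure ActiveInertCat where
  carrier : Type
  [cat : Category.{0} carrier]
  [ai : ActiveInert carrier]

attribute [instance] ActiveInertCat.cat ActiveInertCat.ai

/-- Joyal's category `Θ_n`, with its active and inert morphisms, as the `n`-fold iterated wreath
product of the simplex category: `Θ_0` is the terminal category, `Θ_1` is the simplex category and
`Θ_(n+1)` is the wreath product of the simplex category with `Θ_n`. -/
noncomputable def thetaCat : ℕ → ActiveInertCat
  | 0 => @ActiveInertCat.mk (Discrete PUnit.{1}) _ ⟨fun _ => True, fun _ => True⟩
  | 1 => ⟨SimplexCategory⟩
  | n + 2 => ⟨DeltaWreath (thetaCat (n + 1)).carrier⟩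

abbrev Theta (n : ℕ) : Type := (thetaCat n).carrier

end Theta

end MomentCat

open MomentCat

namespace MomentCat

/-!
The order on moments is containment of inert parts: `φ ≤ ψ` if and only if the inert part of `φ`
factors through that of `ψ`. Active morphisms pull elementary moments back, inert morphisms push
them forward, and so the components of a factorisation, a retraction or an isomorphism in `C ≀ D`
can be built one pair `(α, α')` at a time from those of `D`.

An active morphism between units is invertible, so unitality only has to be tested on a class of
units from which every object is reached by an active morphism. In `C ≀ D` the constant families
`(U, V)` on units `U` and `V` form such a class. They are units because a non-identity moment of `U`
contains no elementary moment: an endomorphism of `(U, V)` over such a moment has no components at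
all, and an endomorphism over `𝟙 U` is an endomorphism of `V`.

In `Δ` the inert morphisms are the translations `x ↦ a + x` and their active retractions the
truncations `x ↦ min (x - a) k`. Since `[1]` is the only unit, the elementary moments of `[m]` are
its `m` segments, and the segment `j` lies in the image of the segment `i` under `f` if and only if
`f (i - 1) < j ≤ f i`. This identifies `Δ ≀ D` with the category of tuples `([m]; T₁, …, Tₘ)`.
-/

open ActiveInert IsMomentCategory

section Moments

variable {C : Type u₁} [Category.{v₁} C] [ActiveInert C]

lemma Moment.sub_iff_exists_comp {A B B' : C} {φ ψ : Moment A} {r : A ⟶ B} {i : B ⟶ A}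
    {s : A ⟶ B'} {j : B' ⟶ A} (hir : i ≫ r = 𝟙 B) (hφ : r ≫ i = φ.1) (hjs : j ≫ s = 𝟙 B')
    (hψ : s ≫ j = ψ.1) : φ.Sub ψ ↔ ∃ c : B ⟶ B', c ≫ j = i := by
  unfold Moment.Sub
  rw [← hφ, ← hψ]
  constructor
  · intro h
    refine ⟨i ≫ s, ?_⟩
    simpa only [Category.assoc, reassoc_of% hir] using congrArg (i ≫ ·) h
  · rintro ⟨c, rfl⟩
    simp only [Category.assoc, reassoc_of% hjs]

lemma IsPrimitive.exists_congr_ne {U : C} (hU : IsPrimitive U) {φ : Moment U} (hφ : φ.1 ≠ 𝟙 U) :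
    ∃ ψ : Moment U, φ.Congr ψ ∧ ψ ≠ φ := by
  simpa only [Moment.Centric, not_forall, exists_prop] using hU.2 φ hφ

lemma Moment.Congr.eq_of_eq_id {A : C} {φ ψ : Moment A} (h : φ.Congr ψ) (hψ : ψ.1 = 𝟙 A) :
    ψ = φ :=
  Subtype.ext (by simpa only [hψ, Category.id_comp, Category.comp_id] using h.2)

lemma El.ext {A : C} {α β : El A} (h : α.1.1 = β.1.1) : α = β := Subtype.ext (Subtype.ext h)

variable [IsMomentCategory C]

lemma act_of_isIso {X Y : C} (f : X ⟶ Y) [IsIso f] : act f := act_of_iso (asIso f)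

lemma inert_of_isIso {X Y : C} (f : X ⟶ Y) [IsIso f] : inert f := inert_of_iso (asIso f)

lemma Moment.sub_refl {A : C} (φ : Moment A) : φ.Sub φ := by
  obtain ⟨B, r, i, -, -, hir, e⟩ := φ.exists_split
  exact (Moment.sub_iff_exists_comp hir e hir e).2 ⟨𝟙 B, Category.id_comp i⟩

lemma Moment.congr_refl {A : C} (φ : Moment A) : φ.Congr φ := by
  have h : φ.1 ≫ φ.1 = φ.1 := φ.sub_refl
  exact ⟨by rw [h, h], by rw [h, h]⟩

/-- The identity of `A`, as a moment of `A`. -/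
def idMoment (A : C) : Moment A :=
  ⟨𝟙 A, by simpa only [Category.comp_id] using
    isMoment_of_retraction (act_id A) (inert_id A) (Category.comp_id _)⟩

lemma Moment.sub_push_iff_exists_comp {A B A' B' E : C} {f : A ⟶ B} {φ : Moment A} {ψ : Moment B}
    {r : A ⟶ A'} {i : A' ⟶ A} {f' : A' ⟶ B'} {k : B' ⟶ B} {s : B ⟶ E} {j : E ⟶ B} (hr : act r)
    (hi : inert i) (hφ : r ≫ i = φ.1) (hf' : act f') (hk : inert k) (hfk : f' ≫ k = i ≫ f)
    (hjs : j ≫ s = 𝟙 E) (hψ : s ≫ j = ψ.1) : ψ.Sub (push f φ) ↔ ∃ c : E ⟶ B', c ≫ k = j := by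
  obtain ⟨t, ⟨ht, hkt⟩, -⟩ := exists_unique_retraction k hk
  exact Moment.sub_iff_exists_comp hjs hψ hkt (push_eq f φ hr hi hφ hf' hk hfk ht hkt).symm

lemma IsUnitObj.exists_comp_eq_section {B E W : C} (hW : IsUnitObj W) {s : B ⟶ W} {j : W ⟶ B}
    (hs : act s) (hj : inert j) (hjs : j ≫ s = 𝟙 W) {a : W ⟶ E} {b : E ⟶ B} (ha : act a)
    (hb : inert b) (habs : a ≫ b ≫ s = 𝟙 W) : ∃ c : W ⟶ E, c ≫ b = j := by
  have hbs : act (b ≫ s) := act_of_act_comp ha (habs ▸ act_id W)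
  obtain ⟨c, ⟨hc, hcbs⟩, -⟩ := hW.2 E (b ≫ s) hbs
  exact ⟨c, section_unique hW hs (inert_comp _ _ hc hb) hj (by rw [Category.assoc, hcbs]) hjs⟩

end Moments

section ElementaryMoments

variable {C : Type u₁} [Category.{v₁} C] [ActiveInert C] [IsMomentCategory C]

/-- The elementary moment `i ∘ r` attached to a splitting `(r, i)` over a unit. -/
def El.ofSplit {A U : C} (hU : IsUnitObj U) {r : A ⟶ U} {i : U ⟶ A} (hr : act r) (hi : inert i)
    (hir : i ≫ r = 𝟙 U) : El A :=
  ⟨⟨r ≫ i, isMoment_of_retraction hr hi hir⟩, U, hU, r, i, hr, hi, rfl⟩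

lemma El.eq_of_sub {A : C} {α β : El A} (h : α.1.Sub β.1) : α = β :=
  (El.eq_of_sub_push_id (by rwa [push_id])).symm

lemma El.exists_sub_push_of_act {A B : C} {f : A ⟶ B} (hf : act f) (γ : El B) :
    ∃ α : El A, γ.1.Sub (push f α.1) := by
  obtain ⟨W, s, j, hW, hs, hj, hjs, e⟩ := γ.exists_split
  have hfs := act_comp _ _ hf hs
  obtain ⟨l, ⟨hl, hlfs⟩, -⟩ := hW.2 A (f ≫ s) hfs
  obtain ⟨E, a, b, ha, hb, hab⟩ := exists_fac (l ≫ f)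
  exact ⟨El.ofSplit hW hfs hl hlfs, (Moment.sub_push_iff_exists_comp hfs hl rfl ha hb hab hjs e).2
    (hW.exists_comp_eq_section hs hj hjs ha hb (by rw [reassoc_of% hab, hlfs]))⟩

lemma isElementary_push_of_inert {A B : C} {i : A ⟶ B} (hi : inert i) (α : El A) :
    (push i α.1).IsElementary := by
  obtain ⟨U, r, j, hU, hr, hj, -, e⟩ := α.exists_split
  have hji := inert_comp _ _ hj hi
  obtain ⟨s, ⟨hs, hjs⟩, -⟩ := exists_unique_retraction _ hji
  exact ⟨U, hU, s, j ≫ i, hs, hji,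
    (push_eq i α.1 hr hj e (act_id U) hji (Category.id_comp _) hs hjs).symm⟩

/-- The pushforward of an elementary moment along an inert morphism, as an elementary moment. -/
noncomputable def El.pushInert {A B : C} {i : A ⟶ B} (hi : inert i) (α : El A) : El B :=
  ⟨push i α.1, isElementary_push_of_inert hi α⟩

lemma El.pushInert_sub_push {A B : C} {i : A ⟶ B} (hi : inert i) (α : El A) :
    (El.pushInert hi α).1.Sub (push i α.1) := Moment.sub_refl _

lemma El.eq_pushInert_of_sub {A B : C} {i : A ⟶ B} (hi : inert i) {α : El A} {β : El B}
    (h : β.1.Sub (push i α.1)) : β = El.pushInert hi α :=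
  El.eq_of_sub (β := El.pushInert hi α) h

lemma El.sub_push_section {A B : C} {i : A ⟶ B} {r : B ⟶ A} (hir : i ≫ r = 𝟙 A)
    {α : El A} {β : El B} (hα : α.1.Sub (push r β.1)) : β.1.Sub (push i α.1) := by
  obtain ⟨β', hβ'α, hαβ'⟩ := El.exists_mid i r α α (by rw [hir]; exact α.sub_push_id)
  rwa [El.eq_of_sub_push r α β β' hα hαβ']

lemma El.sub_push_retraction {A B : C} {i : A ⟶ B} {r : B ⟶ A} (hi : inert i) (hir : i ≫ r = 𝟙 A)
    {α : El A} {β : El B} (hβ : β.1.Sub (push i α.1)) : α.1.Sub (push r β.1) := by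
  rw [El.eq_pushInert_of_sub hi hβ]
  change α.1.Sub (push r (push i α.1))
  rw [← push_comp, hir]
  exact α.sub_push_id

/-- The identity of a unit, as an elementary moment. -/
def El.unit {U : C} (hU : IsUnitObj U) : El U :=
  El.ofSplit hU (act_id U) (inert_id U) (Category.comp_id _)

lemma El.eq_unit {U : C} (hU : IsUnitObj U) (α : El U) : α = El.unit hU := by
  obtain ⟨W, r, i, hW, hr, -, hir, e⟩ := α.exists_split
  obtain ⟨w, rfl⟩ := exists_iso_of_act hU hW hr
  have hi : i = w.inv := by rw [← cancel_mono w.hom, hir, w.inv_hom_id]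
  refine El.ext ?_
  simp [← e, hi, El.unit, El.ofSplit]

lemma El.not_sub_push_of_ne_id {U : C} (hU : IsUnitObj U) (φ : Moment U) (hφ : φ.1 ≠ 𝟙 U)
    (α β : El U) : ¬ β.1.Sub (push φ.1 α.1) := by
  have hpush : (push φ.1 (El.unit hU).1).1 = φ.1 := by
    obtain ⟨A, r, i, hr, hi, hir, e⟩ := φ.exists_split
    rw [push_eq φ.1 (El.unit hU).1 (act_id U) (inert_id U) rfl hr hi (by simp [e]) hr hir, e]
  intro h
  rw [El.eq_unit hU α, El.eq_unit hU β] at h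
  unfold Moment.Sub at h
  rw [hpush] at h
  exact hφ (by simpa [El.unit, El.ofSplit] using h)

end ElementaryMoments

namespace Wreath

section Morphisms

variable {C : Type u₁} [Category.{v₁} C] [ActiveInert C] [IsMomentCategory C]
  {D : Type u₂} [Category.{v₂} D]

lemma hom_ext {X Y : Wreath C D} {f g : X ⟶ Y} (hb : Hom.base f = Hom.base g)
    (ha : ∀ α β h h', Hom.app f α β h = Hom.app g α β h') : f = g :=
  Hom.ext' f g hb ha

lemma comp_app {X Y Z : Wreath C D} (f : X ⟶ Y) (g : Y ⟶ Z) {α : El X.base} {β : El Y.base}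
    {γ : El Z.base} (h₁ : β.1.Sub (push (Hom.base f) α.1)) (h₂ : γ.1.Sub (push (Hom.base g) β.1))
    (h : γ.1.Sub (push (Hom.base f ≫ Hom.base g) α.1)) :
    Hom.app (f ≫ g) α γ h = Hom.app f α β h₁ ≫ Hom.app g β γ h₂ :=
  Hom.comp_app f g α β γ h₁ h₂ h

lemma comp_eq_iff {X Y Z : Wreath C D} {f : X ⟶ Y} {g : Y ⟶ Z} {k : X ⟶ Z} :
    f ≫ g = k ↔ Hom.base f ≫ Hom.base g = Hom.base k ∧
      ∀ α β γ h₁ h₂ h, Hom.app f α β h₁ ≫ Hom.app g β γ h₂ = Hom.app k α γ h := by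
  constructor
  · rintro rfl
    exact ⟨rfl, fun α β γ h₁ h₂ h => (comp_app f g h₁ h₂ h).symm⟩
  · rintro ⟨hb, ha⟩
    refine hom_ext hb fun α γ h h' => ?_
    obtain ⟨β, h₁, h₂⟩ := El.exists_mid _ _ α γ h
    rw [comp_app f g h₁ h₂ h, ha α β γ h₁ h₂ h']

lemma comp_eq_id_iff {X Y : Wreath C D} {f : X ⟶ Y} {g : Y ⟶ X} :
    f ≫ g = 𝟙 X ↔ Hom.base f ≫ Hom.base g = 𝟙 X.base ∧
      ∀ α β h h', Hom.app f α β h ≫ Hom.app g β α h' = 𝟙 (X.fam α) := by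
  rw [comp_eq_iff]
  refine and_congr_right fun _ => ⟨fun ha α β h h' => ha α β α h h' α.sub_push_id,
    fun ha α β γ h h' h'' => ?_⟩
  obtain rfl := El.eq_of_sub_push_id h''
  exact ha α β h h'

/-- The isomorphism of base objects underlying an isomorphism of the wreath product. -/
def baseIso {X Y : Wreath C D} (f : X ≅ Y) : X.base ≅ Y.base :=
  ⟨Hom.base f.hom, Hom.base f.inv, congrArg Hom.base f.hom_inv_id, congrArg Hom.base f.inv_hom_id⟩

/-- The component of an isomorphism of the wreath product at a pair `(α, β)`. -/
def appIso {X Y : Wreath C D} (f : X ≅ Y) (α : El X.base) (β : El Y.base)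
    (h : β.1.Sub (push (baseIso f).hom α.1)) : X.fam α ≅ Y.fam β where
  hom := Hom.app f.hom α β h
  inv := Hom.app f.inv β α (El.sub_push_section (baseIso f).inv_hom_id h)
  hom_inv_id := (comp_eq_id_iff.1 f.hom_inv_id).2 _ _ _ _
  inv_hom_id := (comp_eq_id_iff.1 f.inv_hom_id).2 _ _ _ _

/-- The isomorphism of the wreath product with given base and given components. -/
def isoMk {X Y : Wreath C D} (k : X.base ≅ Y.base)
    (l : ∀ α β, β.1.Sub (push k.hom α.1) → (X.fam α ≅ Y.fam β)) : X ≅ Y where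
  hom := (⟨k.hom, fun α β h => (l α β h).hom⟩ : Hom X Y)
  inv := (⟨k.inv, fun β α h => (l α β (El.sub_push_section k.hom_inv_id h)).inv⟩ : Hom Y X)
  hom_inv_id := comp_eq_id_iff.2 ⟨k.hom_inv_id, fun α β h _ => (l α β h).hom_inv_id⟩
  inv_hom_id := comp_eq_id_iff.2
    ⟨k.inv_hom_id, fun β α h _ => (l α β (El.sub_push_section k.hom_inv_id h)).inv_hom_id⟩

lemma iso_ext {X Y : Wreath C D} {f g : X ≅ Y} (hb : baseIso f = baseIso g)
    (ha : ∀ α β h h', appIso f α β h = appIso g α β h') : f = g :=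
  Iso.ext (hom_ext (congrArg Iso.hom hb) fun α β h h' => congrArg Iso.hom (ha α β h h'))

end Morphisms

section MomentCategory

variable {C : Type u₁} [Category.{v₁} C] [ActiveInert C] [IsMomentCategory C]
  {D : Type u₂} [Category.{v₂} D] [ActiveInert D] [IsMomentCategory D]

lemma exists_act_inert_fac {X Y : Wreath C D} (f : X ⟶ Y) :
    ∃ (Z : Wreath C D) (a : X ⟶ Z) (i : Z ⟶ Y), act a ∧ inert i ∧ a ≫ i = f := by
  obtain ⟨E, a, i, ha, hi, e⟩ := exists_fac (Hom.base f)
  choose p hp using El.exists_sub_push_of_act ha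
  have hpi : ∀ ε : El E, (El.pushInert hi ε).1.Sub (push (Hom.base f) (p ε).1) := fun ε =>
    e ▸ El.sub_push_comp (hp ε) (El.pushInert_sub_push hi ε)
  choose Z b j hb hj hbj using fun ε => exists_fac (Hom.app f _ _ (hpi ε))
  refine ⟨⟨E, Z⟩,
    (⟨a, fun α ε h =>
      eqToHom (congrArg X.fam (El.eq_of_sub_push a ε _ _ h (hp ε))) ≫ b ε⟩ : Hom X ⟨E, Z⟩),
    (⟨i, fun ε β h =>
      j ε ≫ eqToHom (congrArg Y.fam (El.eq_pushInert_of_sub hi h).symm)⟩ : Hom ⟨E, Z⟩ Y),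
    ⟨ha, fun α ε h => act_comp _ _ (act_of_isIso _) (hb ε)⟩,
    ⟨hi, fun ε β h => inert_comp _ _ (hj ε) (inert_of_isIso _)⟩,
    comp_eq_iff.2 ⟨e, fun α ε β h₁ h₂ h => ?_⟩⟩
  obtain rfl := El.eq_of_sub_push a ε _ _ h₁ (hp ε)
  obtain rfl := El.eq_pushInert_of_sub hi h₂
  simp only [eqToHom_refl, Category.id_comp, Category.comp_id, hbj]

lemma existsUnique_component_iso {X Y Z Z' : Wreath C D} {a : X ⟶ Z} {i : Z ⟶ Y} {a' : X ⟶ Z'}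
    {i' : Z' ⟶ Y} (ha : act a) (hi : inert i) (ha' : act a') (hi' : inert i')
    (e : a ≫ i = a' ≫ i') {k : Z.base ⟶ Z'.base} (hk : Hom.base a ≫ k = Hom.base a')
    (hk' : k ≫ Hom.base i' = Hom.base i) (ζ : El Z.base) (ζ' : El Z'.base)
    (hζ : ζ'.1.Sub (push k ζ.1)) :
    ∃! l : Z.fam ζ ≅ Z'.fam ζ', (∀ α h h', Hom.app a α ζ h ≫ l.hom = Hom.app a' α ζ' h') ∧
      (∀ β h h', l.hom ≫ Hom.app i' ζ' β h' = Hom.app i ζ β h) := by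
  obtain ⟨α, hα⟩ := El.exists_sub_push_of_act ha.1 ζ
  have hα' : ζ'.1.Sub (push (Hom.base a') α.1) := hk ▸ El.sub_push_comp hα hζ
  have hβ' := El.pushInert_sub_push hi'.1 ζ'
  have hβ : (El.pushInert hi'.1 ζ').1.Sub (push (Hom.base i) ζ.1) :=
    hk' ▸ El.sub_push_comp hζ hβ'
  have hcomp : Hom.app a α ζ hα ≫ Hom.app i ζ _ hβ = Hom.app a' α ζ' hα' ≫ Hom.app i' ζ' _ hβ' :=
    ((comp_eq_iff.1 e).2 _ _ _ _ _ (El.sub_push_comp hα' hβ')).trans (comp_app a' i' hα' hβ' _)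
  obtain ⟨l, ⟨hl, hl'⟩, hlu⟩ := fac_unique _ _ _ _ (ha.2 α ζ hα) (hi.2 _ _ hβ) (ha'.2 _ _ hα')
    (hi'.2 _ _ hβ') hcomp
  refine ⟨l, ⟨fun α₁ h h' => ?_, fun β₁ h h' => ?_⟩, fun m hm => hlu m ⟨hm.1 _ _ _, hm.2 _ _ _⟩⟩
  · obtain rfl := El.eq_of_sub_push _ _ _ _ h hα
    exact hl
  · obtain rfl := El.eq_pushInert_of_sub hi'.1 h'
    exact hl'

lemma existsUnique_fac_iso {X Y Z Z' : Wreath C D} (a : X ⟶ Z) (i : Z ⟶ Y) (a' : X ⟶ Z')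
    (i' : Z' ⟶ Y) (ha : act a) (hi : inert i) (ha' : act a') (hi' : inert i')
    (e : a ≫ i = a' ≫ i') : ∃! h : Z ≅ Z', a ≫ h.hom = a' ∧ h.hom ≫ i' = i := by
  obtain ⟨k, ⟨hk, hk'⟩, hku⟩ := fac_unique (Hom.base a) (Hom.base i) (Hom.base a') (Hom.base i')
    ha.1 hi.1 ha'.1 hi'.1 (congrArg Hom.base e)
  choose l hl hlu using existsUnique_component_iso ha hi ha' hi' e hk hk'
  refine ⟨isoMk k l, ⟨comp_eq_iff.2 ⟨hk, fun α ζ ζ' h₁ h₂ h => (hl ζ ζ' h₂).1 α h₁ h⟩,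
    comp_eq_iff.2 ⟨hk', fun ζ ζ' β h₁ h₂ h => (hl ζ ζ' h₁).2 β h h₂⟩⟩, ?_⟩
  rintro M ⟨hM, hM'⟩
  have hMb : baseIso M = k := hku _ ⟨congrArg Hom.base hM, congrArg Hom.base hM'⟩
  exact iso_ext hMb fun ζ ζ' h h' => hlu ζ ζ' h' _
    ⟨fun α _ _ => (comp_eq_iff.1 hM).2 α ζ ζ' _ h _,
      fun β _ _ => (comp_eq_iff.1 hM').2 ζ ζ' β h _ _⟩

lemma existsUnique_act_retraction {X Y : Wreath C D} (i : X ⟶ Y) (hi : inert i) :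
    ∃! r : Y ⟶ X, act r ∧ i ≫ r = 𝟙 X := by
  obtain ⟨r, ⟨hr, hir⟩, hru⟩ := exists_unique_retraction (Hom.base i) hi.1
  choose s hs hsu using fun (β : El Y.base) (α : El X.base) (h : α.1.Sub (push r β.1)) =>
    exists_unique_retraction (Hom.app i α β (El.sub_push_section hir h)) (hi.2 _ _ _)
  refine ⟨(⟨r, s⟩ : Hom Y X), ⟨⟨hr, fun β α h => (hs β α h).1⟩,
    comp_eq_id_iff.2 ⟨hir, fun α β _ h => (hs β α h).2⟩⟩, ?_⟩
  rintro t ⟨ht, hit⟩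
  exact hom_ext (hru _ ⟨ht.1, congrArg Hom.base hit⟩) fun β α h h' =>
    hsu β α h' _ ⟨ht.2 _ _ _, (comp_eq_id_iff.1 hit).2 _ _ _ _⟩

lemma eq_act_retraction_comp {X Y Z : Wreath C D} (i : X ⟶ Y) (f : Y ⟶ Z) (g : X ⟶ Z)
    (r : Y ⟶ X) (hi : inert i) (hf : act f) (hg : act g) (hr : act r) (hir : i ≫ r = 𝟙 X)
    (hif : i ≫ f = g) : f = r ≫ g := by
  obtain ⟨hirb, hira⟩ := comp_eq_id_iff.1 hir
  obtain ⟨hifb, hifa⟩ := comp_eq_iff.1 hif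
  refine (comp_eq_iff.2 ⟨(eq_retraction_comp _ _ _ _ hi.1 hf.1 hg.1 hr.1 hirb hifb).symm,
    fun β α γ h₁ h₂ h => ?_⟩).symm
  have hαβ := El.sub_push_section hirb h₁
  exact (eq_retraction_comp (Hom.app i α β hαβ) _ _ _ (hi.2 _ _ _) (hf.2 _ _ _) (hg.2 _ _ _)
    (hr.2 _ _ _) (hira _ _ _ _) (hifa _ _ _ _ _ _)).symm

instance instIsMomentCategory : IsMomentCategory (Wreath C D) where
  act_of_iso k := ⟨act_of_iso (baseIso k), fun α β h => act_of_iso (appIso k α β h)⟩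
  inert_of_iso k := ⟨inert_of_iso (baseIso k), fun α β h => inert_of_iso (appIso k α β h)⟩
  act_comp f g hf hg := ⟨act_comp _ _ hf.1 hg.1, fun α γ h => by
    obtain ⟨β, h₁, h₂⟩ := El.exists_mid _ _ α γ h
    exact comp_app f g h₁ h₂ h ▸ act_comp _ _ (hf.2 α β h₁) (hg.2 β γ h₂)⟩
  inert_comp f g hf hg := ⟨inert_comp _ _ hf.1 hg.1, fun α γ h => by
    obtain ⟨β, h₁, h₂⟩ := El.exists_mid _ _ α γ h
    exact comp_app f g h₁ h₂ h ▸ inert_comp _ _ (hf.2 α β h₁) (hg.2 β γ h₂)⟩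
  exists_fac := exists_act_inert_fac
  fac_unique := existsUnique_fac_iso
  exists_unique_retraction := existsUnique_act_retraction
  eq_retraction_comp := eq_act_retraction_comp

end MomentCategory

end Wreath

section UnitCover

variable {C : Type u₁} [Category.{v₁} C] [ActiveInert C]

/-- A class of units from which every object is reached by an active morphism. -/
structure IsUnitCover (P : C → Prop) : Prop where
  isUnitObj : ∀ {U : C}, P U → IsUnitObj U
  exists_act : ∀ A : C, ∃ (U : C) (φ : U ⟶ A), P U ∧ act φ

namespace IsUnitCover

variable [IsMomentCategory C] {P : C → Prop}

lemma exists_iso (hP : IsUnitCover P) {U : C} (hU : IsUnitObj U) :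
    ∃ S : C, P S ∧ Nonempty (S ≅ U) := by
  obtain ⟨S, f, hS, hf⟩ := hP.exists_act U
  obtain ⟨k, -⟩ := exists_iso_of_act (hP.isUnitObj hS) hU hf
  exact ⟨S, hS, ⟨k⟩⟩

theorem isUnital (hP : IsUnitCover P)
    (huniq : ∀ {A U U' : C} (φ : U ⟶ A) (φ' : U' ⟶ A), P U → P U' → act φ → act φ' →
      ∃! h : U ≅ U', h.hom ≫ φ' = φ) : IsUnital C where
  exists_unit A := by
    obtain ⟨U, φ, hU, hφ⟩ := hP.exists_act A
    exact ⟨U, φ, hP.isUnitObj hU, hφ⟩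
  unit_unique {A U U'} φ φ' hU hU' hφ hφ' := by
    obtain ⟨S, hS, ⟨k⟩⟩ := hP.exists_iso hU
    obtain ⟨S', hS', ⟨k'⟩⟩ := hP.exists_iso hU'
    refine ((Iso.isoCongr k k').existsUnique_congr fun {m} => ?_).1
      (huniq (k.hom ≫ φ) (k'.hom ≫ φ') hS hS' (act_comp _ _ (act_of_iso k) hφ)
        (act_comp _ _ (act_of_iso k') hφ'))
    simp [Iso.isoCongr, Iso.inv_comp_eq]

theorem hasEssentiallyUniqueUnit (hP : IsUnitCover P) (hne : ∃ U, P U)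
    (huniq : ∀ U U' : C, P U → P U' → Nonempty (Unique (U ≅ U'))) :
    HasEssentiallyUniqueUnit C := by
  refine ⟨hne.imp fun _ => hP.isUnitObj, fun U U' hU hU' => ?_⟩
  obtain ⟨S, hS, ⟨k⟩⟩ := hP.exists_iso hU
  obtain ⟨S', hS', ⟨k'⟩⟩ := hP.exists_iso hU'
  obtain ⟨h⟩ := huniq S S' hS hS'
  exact ⟨(Iso.isoCongr k k').symm.unique⟩

end IsUnitCover

end UnitCover

namespace Wreath

section ConstantFamilies

variable {C : Type u₁} [Category.{v₁} C] [ActiveInert C] [IsMomentCategory C]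
  {D : Type u₂} [Category.{v₂} D]

/-- The object of the wreath product with a constant family. -/
def const (U : C) (V : D) : Wreath C D := ⟨U, fun _ => V⟩

/-- The morphism between constant families all of whose components are equal. -/
def constMap {U U' : C} {V V' : D} (f : U ⟶ U') (w : V ⟶ V') : const U V ⟶ const U' V' :=
  (⟨f, fun _ _ _ => w⟩ : Hom (const U V) (const U' V'))

lemma constMap_comp {U U' U'' : C} {V V' V'' : D} (f : U ⟶ U') (f' : U' ⟶ U'')
    (w : V ⟶ V') (w' : V' ⟶ V'') :
    constMap f w ≫ constMap f' w' = constMap (f ≫ f') (w ≫ w') :=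
  comp_eq_iff.2 ⟨rfl, fun _ _ _ _ _ _ => rfl⟩

lemma constMap_id (U : C) (V : D) : constMap (𝟙 U) (𝟙 V) = 𝟙 (const U V) :=
  hom_ext rfl fun _ _ _ _ => rfl

/-- The isomorphism between constant families all of whose components are equal. -/
def constIso {U U' : C} {V V' : D} (f : U ≅ U') (w : V ≅ V') : const U V ≅ const U' V' :=
  isoMk f fun _ _ _ => w

lemma app_unit_constMap_id {U : C} {V : D} (hU : IsUnitObj U) {f : const U V ⟶ const U V}
    {w : V ⟶ V} (e : constMap (𝟙 U) w = f)
    (h : (El.unit hU).1.Sub (push (Hom.base f) (El.unit hU).1)) :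
    Hom.app f (El.unit hU) (El.unit hU) h = w := by
  subst e
  rfl

lemma eq_constMap_of_base_eq_id {U : C} {V : D} (hU : IsUnitObj U) {f : const U V ⟶ const U V}
    (hf : Hom.base f = 𝟙 U) (h : (El.unit hU).1.Sub (push (Hom.base f) (El.unit hU).1)) :
    f = constMap (𝟙 U) (Hom.app f (El.unit hU) (El.unit hU) h) := by
  refine hom_ext hf fun α β h' _ => ?_
  obtain rfl := El.eq_unit hU α
  obtain rfl := El.eq_unit hU β
  rfl

lemma hom_eq_of_base_ne_id {X : Wreath C D} (hX : IsUnitObj X.base) {f g : X ⟶ X}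
    (hf : IsMoment (Hom.base f)) (hne : Hom.base f ≠ 𝟙 X.base) (h : Hom.base f = Hom.base g) :
    f = g :=
  hom_ext h fun α β hαβ _ => (El.not_sub_push_of_ne_id hX ⟨_, hf⟩ hne α β hαβ).elim

end ConstantFamilies

section Units

variable {C : Type u₁} [Category.{v₁} C] [ActiveInert C] [IsMomentCategory C]
  {D : Type u₂} [Category.{v₂} D] [ActiveInert D] [IsMomentCategory D]

lemma isMoment_base {X : Wreath C D} (Φ : Moment X) : IsMoment (Hom.base Φ.1) := by
  obtain ⟨Z, r, i, hr, hi, hir, e⟩ := Φ.exists_split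
  rw [← e]
  exact isMoment_of_retraction hr.1 hi.1 (congrArg Hom.base hir)

lemma isMoment_app {X : Wreath C D} (Φ : Moment X) (α : El X.base)
    (h : α.1.Sub (push (Hom.base Φ.1) α.1)) : IsMoment (Hom.app Φ.1 α α h) := by
  obtain ⟨Z, r, i, hr, hi, hir, e⟩ := Φ.exists_split
  have hb : Hom.base r ≫ Hom.base i = Hom.base Φ.1 := congrArg Hom.base e
  obtain ⟨ζ, h₁, h₂⟩ := El.exists_mid (Hom.base r) (Hom.base i) α α (by rwa [hb])
  rw [← (comp_eq_iff.1 e).2 α ζ α h₁ h₂ h]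
  exact isMoment_of_retraction (hr.2 α ζ h₁) (hi.2 ζ α h₂) ((comp_eq_id_iff.1 hir).2 ζ α h₂ h₁)

/-- The moment `(φ, w)` of a constant family. -/
def constMoment {U : C} {V : D} (φ : Moment U) (w : Moment V) : Moment (const U V) :=
  ⟨constMap φ.1 w.1, by
    obtain ⟨A, r, i, hr, hi, hir, e⟩ := φ.exists_split
    obtain ⟨B, s, j, hs, hj, hjs, e'⟩ := w.exists_split
    rw [← e, ← e', ← constMap_comp]
    refine isMoment_of_retraction ⟨hr, fun _ _ _ => hs⟩ ⟨hi, fun _ _ _ => hj⟩ ?_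
    rw [constMap_comp, hir, hjs, constMap_id]⟩

lemma constMoment_congr {U : C} {V : D} {φ φ' : Moment U} {w w' : Moment V} (h : φ.Congr φ')
    (hw : w.Congr w') : (constMoment φ w).Congr (constMoment φ' w') := by
  simp only [Moment.Congr, constMoment, constMap_comp]
  exact ⟨congrArg₂ constMap h.1 hw.1, congrArg₂ constMap h.2 hw.2⟩

lemma not_centric_of_base_ne_id {U : C} {V : D} (hU : IsUnitObj U) (Φ : Moment (const U V))
    (hb : Hom.base Φ.1 ≠ 𝟙 U) : ¬ Φ.Centric := by
  let φ : Moment U := ⟨_, isMoment_base Φ⟩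
  obtain ⟨ψ, hφψ, hne⟩ := hU.1.exists_congr_ne (φ := φ) hb
  have hψ : ψ.1 ≠ 𝟙 U := fun h => hne (hφψ.eq_of_eq_id h)
  intro hΦ
  have hΨΦ : constMoment ψ (idMoment V) = Φ :=
    hΦ _ ⟨hom_eq_of_base_ne_id hU φ.2 hb hφψ.1, hom_eq_of_base_ne_id hU ψ.2 hψ hφψ.2⟩
  exact hne (Subtype.ext (congrArg (fun Ψ => Hom.base Ψ.1) hΨΦ))

lemma exists_eq_constMoment_of_base_eq_id {U : C} {V : D} (hU : IsUnitObj U)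
    {Φ : Moment (const U V)} (hb : Hom.base Φ.1 = 𝟙 U) :
    ∃ w : Moment V, Φ = constMoment (idMoment U) w := by
  have hu : (El.unit hU).1.Sub (push (Hom.base Φ.1) (El.unit hU).1) := hb ▸ El.sub_push_id _
  exact ⟨⟨_, isMoment_app Φ (El.unit hU) hu⟩, Subtype.ext (eq_constMap_of_base_eq_id hU hb hu)⟩

lemma constMoment_id_injective {U : C} {V : D} (hU : IsUnitObj U) :
    Function.Injective (constMoment (V := V) (idMoment U)) := fun _ _ h =>
  Subtype.ext (app_unit_constMap_id hU (congrArg Subtype.val h) (El.sub_push_id (El.unit hU))).symm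

lemma not_centric_of_base_eq_id {U : C} {V : D} (hU : IsUnitObj U) (hV : IsUnitObj V)
    {Φ : Moment (const U V)} (hΦ : Φ.1 ≠ 𝟙 (const U V)) (hb : Hom.base Φ.1 = 𝟙 U) :
    ¬ Φ.Centric := by
  obtain ⟨w, rfl⟩ := exists_eq_constMoment_of_base_eq_id hU hb
  have hw : w.1 ≠ 𝟙 V := fun h => hΦ ((congrArg (constMap (𝟙 U)) h).trans (constMap_id U V))
  obtain ⟨w', hww', hne⟩ := hV.1.exists_congr_ne hw
  exact fun hc => hne (constMoment_id_injective hU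
    (hc _ (constMoment_congr (Moment.congr_refl (idMoment U)) hww')))

lemma isPrimitive_const {U : C} {V : D} (hU : IsUnitObj U) (hV : IsUnitObj V) :
    IsPrimitive (const U V) := by
  obtain ⟨φ, hφ⟩ := hU.1.1
  refine ⟨⟨constMoment φ (idMoment V), fun h => hφ (congrArg Hom.base h)⟩, fun Φ hΦ => ?_⟩
  by_cases hb : Hom.base Φ.1 = 𝟙 U
  · exact not_centric_of_base_eq_id hU hV hΦ hb
  · exact not_centric_of_base_ne_id hU Φ hb

lemma isUnitObj_const {U : C} {V : D} (hU : IsUnitObj U) (hV : IsUnitObj V) :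
    IsUnitObj (const U V) := by
  refine ⟨isPrimitive_const hU hV, fun X f hf => ?_⟩
  obtain ⟨i, ⟨hi, hif⟩, hiu⟩ := hU.2 _ _ hf.1
  choose j hj hju using fun (α : El U) (β : El X.base) (h : β.1.Sub (push i α.1)) =>
    hV.2 _ _ (hf.2 β α (El.sub_push_retraction hi hif h))
  refine ⟨(⟨i, j⟩ : Hom (const U V) X), ⟨⟨hi, fun α β h => (hj α β h).1⟩,
    comp_eq_id_iff.2 ⟨hif, fun α β h _ => (hj α β h).2⟩⟩, ?_⟩
  rintro t ⟨ht, htf⟩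
  exact hom_ext (hiu _ ⟨ht.1, congrArg Hom.base htf⟩) fun α β h h' =>
    hju α β h' _ ⟨ht.2 _ _ _, (comp_eq_id_iff.1 htf).2 _ _ _ _⟩

/-- The objects `(U, V)` of the wreath product with `U` and `V` units. -/
def IsConstUnit (X : Wreath C D) : Prop :=
  ∃ (U : C) (V : D), IsUnitObj U ∧ IsUnitObj V ∧ X = const U V

end Units

section Unital

variable {C : Type u₁} [Category.{v₁} C] [ActiveInert C] [IsUnital C]
  {D : Type u₂} [Category.{v₂} D] [ActiveInert D] [IsUnital D]

lemma isUnitCover_isConstUnit (hD : HasEssentiallyUniqueUnit D) :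
    IsUnitCover (IsConstUnit (C := C) (D := D)) where
  isUnitObj := by
    rintro _ ⟨U, V, hU, hV, rfl⟩
    exact isUnitObj_const hU hV
  exists_act X := by
    obtain ⟨U, φ, hU, hφ⟩ := IsUnital.exists_unit X.base
    obtain ⟨⟨V, hV⟩, hVuniq⟩ := hD
    have hact (B : D) : ∃ f : V ⟶ B, act f := by
      obtain ⟨W, g, hW, hg⟩ := IsUnital.exists_unit B
      obtain ⟨k⟩ := hVuniq V W hV hW
      exact ⟨k.default.hom ≫ g, act_comp _ _ (act_of_iso _) hg⟩
    choose f hf using fun α => hact (X.fam α)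
    exact ⟨const U V, (⟨φ, fun _ α _ => f α⟩ : Hom (const U V) X), ⟨U, V, hU, hV, rfl⟩, hφ,
      fun _ α _ => hf α⟩

theorem isUnital (hD : HasEssentiallyUniqueUnit D) : IsUnital (Wreath C D) := by
  refine (isUnitCover_isConstUnit hD).isUnital ?_
  rintro X _ _ φ φ' ⟨U, V, hU, hV, rfl⟩ ⟨U', V', hU', hV', rfl⟩ hφ hφ'
  obtain ⟨h, hh, hhu⟩ := IsUnital.unit_unique (Hom.base φ) (Hom.base φ') hU hU' hφ.1 hφ'.1
  obtain ⟨k, hk⟩ := (hD.2 V V' hV hV').some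
  refine ⟨constIso h k.default, comp_eq_iff.2 ⟨hh, fun α β γ _ hβγ hαγ => ?_⟩, fun m hm =>
    iso_ext (hhu (baseIso m) (congrArg Hom.base hm)) fun α β h _ => hk (appIso m α β h)⟩
  obtain ⟨l, hl, -⟩ := IsUnital.unit_unique (Hom.app φ α γ hαγ) (Hom.app φ' β γ hβγ) hV hV'
    (hφ.2 _ _ _) (hφ'.2 _ _ _)
  rw [← hl, hk l]
  rfl

theorem hasEssentiallyUniqueUnit (hC : HasEssentiallyUniqueUnit C)
    (hD : HasEssentiallyUniqueUnit D) : HasEssentiallyUniqueUnit (Wreath C D) := by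
  refine (isUnitCover_isConstUnit hD).hasEssentiallyUniqueUnit ?_ ?_
  · obtain ⟨U, hU⟩ := hC.1
    obtain ⟨V, hV⟩ := hD.1
    exact ⟨const U V, U, V, hU, hV, rfl⟩
  · rintro _ _ ⟨U, V, hU, hV, rfl⟩ ⟨U', V', hU', hV', rfl⟩
    obtain ⟨h, hh⟩ := (hC.2 U U' hU hU').some
    obtain ⟨k, hk⟩ := (hD.2 V V' hV hV').some
    exact ⟨⟨⟨constIso h.default k.default⟩, fun m =>
      iso_ext (hh (baseIso m)) fun α β h _ => hk (appIso m α β h)⟩⟩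

end Unital

end Wreath

section Faithful

variable {C : Type u₁} [Category.{v₁} C] {D : Type u₂} [Category.{v₂} D] (F : C ⥤ D) [F.Faithful]

lemma map_comp_map_eq_map_iff {X Y Z : C} {f : X ⟶ Y} {g : Y ⟶ Z}
    {h : X ⟶ Z} : F.map f ≫ F.map g = F.map h ↔ f ≫ g = h := by
  rw [← F.map_comp, F.map_injective.eq_iff]

lemma map_comp_map_eq_id_iff {X Y : C} {f : X ⟶ Y} {g : Y ⟶ X} :
    F.map f ≫ F.map g = 𝟙 (F.obj X) ↔ f ≫ g = 𝟙 X := by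
  rw [← F.map_id, map_comp_map_eq_map_iff]

end Faithful

section Transfer

variable {C : Type u₁} [Category.{v₁} C] [ActiveInert C]
  {D : Type u₂} [Category.{v₂} D] [ActiveInert D]

lemma IsPrimitive.of_mulEquiv {X : C} {U : D} (hU : IsPrimitive U) (e : End X ≃* End U)
    (he : ∀ φ : End X, IsMoment (e φ) ↔ IsMoment φ) : IsPrimitive X := by
  let m : Moment X ≃ Moment U := e.toEquiv.subtypeEquiv fun φ => (he φ).symm
  have m_ne_id : ∀ φ : Moment X, (m φ).1 ≠ 𝟙 U ↔ φ.1 ≠ 𝟙 X := fun φ =>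
    not_congr (map_eq_one_iff e e.injective)
  have map_triple : ∀ φ ψ χ : End X, e (φ ≫ ψ ≫ χ) = e φ ≫ e ψ ≫ e χ := fun φ ψ χ =>
    (map_mul e (χ * ψ) φ).trans (congrArg (· * e φ) (map_mul e χ ψ))
  have congr_of_m : ∀ φ ψ : Moment X, (m φ).Congr (m ψ) → φ.Congr ψ := fun φ ψ h =>
    ⟨e.injective (h.1.trans (map_triple φ.1 ψ.1 φ.1).symm),
      e.injective (h.2.trans (map_triple ψ.1 φ.1 ψ.1).symm)⟩
  refine ⟨?_, fun φ hφ hc => hU.2 (m φ) ((m_ne_id φ).2 hφ) fun ψ hψ => ?_⟩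
  · obtain ⟨ψ, hψ⟩ := hU.1
    exact ⟨m.symm ψ, (m_ne_id _).1 (by rwa [m.apply_symm_apply])⟩
  · obtain ⟨χ, rfl⟩ := m.surjective ψ
    exact congrArg m (hc χ (congr_of_m φ χ hψ))

lemma IsMoment.conj [IsMomentCategory C] {X Y : C} {φ : X ⟶ X} (hφ : IsMoment φ) (w : X ≅ Y) :
    IsMoment (w.inv ≫ φ ≫ w.hom) := by
  intro B r i hr hi hri
  have := hφ B (w.hom ≫ r) (i ≫ w.inv) (act_comp _ _ (act_of_iso w) hr)
    (inert_comp _ _ hi (inert_of_iso w.symm)) (by simp [reassoc_of% hri])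
  simpa using this

lemma IsUnitObj.of_iso [IsMomentCategory C] {U V : C} (hU : IsUnitObj U) (w : U ≅ V) :
    IsUnitObj V := by
  refine ⟨hU.1.of_mulEquiv w.symm.conj fun φ => ⟨fun h => ?_, fun h => h.conj w.symm⟩,
    fun X f hf => ?_⟩
  · simpa [Iso.conj_apply] using h.conj w
  · refine ((w.homFromEquiv (Z := X)).existsUnique_congr fun {i} => ?_).1
      (hU.2 X (f ≫ w.inv) (act_comp _ _ hf (act_of_iso w.symm)))
    refine and_congr ⟨fun h => inert_comp _ _ (inert_of_iso w.symm) h, fun h => ?_⟩ ?_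
    · simpa using inert_comp _ _ (inert_of_iso w) h
    · rw [← Category.assoc, Iso.comp_inv_eq, Iso.homFromEquiv_apply, Category.assoc,
        Iso.inv_comp_eq, Category.id_comp, Category.comp_id]

/-- A functor that preserves and reflects the active and the inert morphisms. -/
structure DetectsActiveInert (F : C ⥤ D) : Prop where
  act_iff : ∀ {X Y : C} (f : X ⟶ Y), act (F.map f) ↔ act f
  inert_iff : ∀ {X Y : C} (f : X ⟶ Y), inert (F.map f) ↔ inert f

namespace DetectsActiveInert

variable {F : C ⥤ D} [F.IsEquivalence]

lemma exists_act_inert_fac [IsMomentCategory D] (hF : DetectsActiveInert F) {X Y : C}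
    (f : X ⟶ Y) : ∃ (Z : C) (a : X ⟶ Z) (i : Z ⟶ Y), act a ∧ inert i ∧ a ≫ i = f := by
  obtain ⟨Z, a, i, ha, hi, e⟩ := exists_fac (F.map f)
  let w := F.objObjPreimageIso Z
  refine ⟨F.objPreimage Z, F.preimage (a ≫ w.inv), F.preimage (w.hom ≫ i), ?_, ?_,
    F.map_injective (by simp [e])⟩
  · rw [← hF.act_iff, F.map_preimage]
    exact act_comp _ _ ha (act_of_iso w.symm)
  · rw [← hF.inert_iff, F.map_preimage]
    exact inert_comp _ _ (inert_of_iso w) hi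

theorem isMomentCategory [IsMomentCategory D] (hF : DetectsActiveInert F) :
    IsMomentCategory C where
  act_of_iso h := (hF.act_iff _).1 (act_of_iso (F.mapIso h))
  inert_of_iso h := (hF.inert_iff _).1 (inert_of_iso (F.mapIso h))
  act_comp f g hf hg := by
    rw [← hF.act_iff] at hf hg ⊢
    rw [F.map_comp]
    exact act_comp _ _ hf hg
  inert_comp f g hf hg := by
    rw [← hF.inert_iff] at hf hg ⊢
    rw [F.map_comp]
    exact inert_comp _ _ hf hg
  exists_fac f := hF.exists_act_inert_fac f
  fac_unique a i a' i' ha hi ha' hi' e := by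
    rw [← hF.act_iff] at ha ha'
    rw [← hF.inert_iff] at hi hi'
    refine ((Functor.FullyFaithful.ofFullyFaithful F).isoEquiv.existsUnique_congr
      fun {k} => ?_).2 (fac_unique _ _ _ _ ha hi ha' hi' (by rw [← F.map_comp, ← F.map_comp, e]))
    exact and_congr (map_comp_map_eq_map_iff F).symm (map_comp_map_eq_map_iff F).symm
  exists_unique_retraction i hi := by
    refine ((Functor.FullyFaithful.ofFullyFaithful F).homEquiv.existsUnique_congr
      fun {r} => ?_).2 (exists_unique_retraction (F.map i) ((hF.inert_iff i).2 hi))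
    exact and_congr (hF.act_iff r).symm (map_comp_map_eq_id_iff F).symm
  eq_retraction_comp i f g r hi hf hg hr hir hif := by
    apply F.map_injective
    rw [F.map_comp]
    exact eq_retraction_comp (F.map i) _ _ _ ((hF.inert_iff i).2 hi) ((hF.act_iff f).2 hf)
      ((hF.act_iff g).2 hg) ((hF.act_iff r).2 hr) ((map_comp_map_eq_id_iff F).2 hir)
      ((map_comp_map_eq_map_iff F).2 hif)

lemma isMoment_map_iff [IsMomentCategory D] (hF : DetectsActiveInert F) {X : C} {φ : X ⟶ X} :
    IsMoment (F.map φ) ↔ IsMoment φ := by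
  have := hF.isMomentCategory
  refine ⟨fun h B r i hr hi hri => F.map_injective ?_, fun h => ?_⟩
  · rw [F.map_comp, F.map_id]
    exact h _ _ _ ((hF.act_iff r).2 hr) ((hF.inert_iff i).2 hi)
      ((map_comp_map_eq_map_iff F).2 hri)
  · obtain ⟨B, r, i, hr, hi, hir, hri⟩ := Moment.exists_split ⟨φ, h⟩
    rw [show φ = r ≫ i from hri.symm, F.map_comp]
    exact isMoment_of_retraction ((hF.act_iff r).2 hr) ((hF.inert_iff i).2 hi)
      ((map_comp_map_eq_id_iff F).2 hir)

lemma isUnitObj_of_map [IsMomentCategory D] (hF : DetectsActiveInert F) {X : C}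
    (hX : IsUnitObj (F.obj X)) : IsUnitObj X := by
  let E := Functor.FullyFaithful.ofFullyFaithful F
  refine ⟨hX.1.of_mulEquiv (E.mulEquivEnd X) fun φ => hF.isMoment_map_iff, fun Y f hf => ?_⟩
  refine (E.homEquiv.existsUnique_congr fun {i} => ?_).2 (hX.2 _ (F.map f) ((hF.act_iff f).2 hf))
  exact and_congr (hF.inert_iff i).symm (map_comp_map_eq_id_iff F).symm

lemma isUnitCover [IsMomentCategory D] (hF : DetectsActiveInert F)
    (hD : ∀ A : D, ∃ (U : D) (φ : U ⟶ A), IsUnitObj U ∧ act φ) :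
    IsUnitCover fun X : C => IsUnitObj (F.obj X) where
  isUnitObj := hF.isUnitObj_of_map
  exists_act A := by
    obtain ⟨U, φ, hU, hφ⟩ := hD (F.obj A)
    let w := F.objObjPreimageIso U
    refine ⟨F.objPreimage U, F.preimage (w.hom ≫ φ), hU.of_iso w.symm, ?_⟩
    rw [← hF.act_iff, F.map_preimage]
    exact act_comp _ _ (act_of_iso w) hφ

theorem isUnital [IsUnital D] (hF : DetectsActiveInert F) : IsUnital C := by
  have := hF.isMomentCategory
  let E := Functor.FullyFaithful.ofFullyFaithful F
  refine (hF.isUnitCover IsUnital.exists_unit).isUnital fun φ φ' hU hU' hφ hφ' => ?_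
  refine (E.isoEquiv.existsUnique_congr fun {h} => ?_).2 (IsUnital.unit_unique (F.map φ)
    (F.map φ') hU hU' ((hF.act_iff φ).2 hφ) ((hF.act_iff φ').2 hφ'))
  exact (map_comp_map_eq_map_iff F).symm

theorem hasEssentiallyUniqueUnit [IsUnital D] (hF : DetectsActiveInert F)
    (hD : HasEssentiallyUniqueUnit D) : HasEssentiallyUniqueUnit C := by
  have := hF.isMomentCategory
  let E := Functor.FullyFaithful.ofFullyFaithful F
  refine (hF.isUnitCover IsUnital.exists_unit).hasEssentiallyUniqueUnit ?_ fun U U' hU hU' => ?_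
  · obtain ⟨V, hV⟩ := hD.1
    exact ⟨F.objPreimage V, hV.of_iso (F.objObjPreimageIso V).symm⟩
  · obtain ⟨h⟩ := hD.2 _ _ hU hU'
    exact ⟨E.isoEquiv.unique⟩

end DetectsActiveInert

end Transfer

section Simplex

open SimplexCategory
open scoped Simplicial

/-- A simplicial operator as a function on natural numbers, constant from the last vertex on; this
makes pointwise identities accessible to linear arithmetic. -/
def evalNat {X Y : SimplexCategory} (f : X ⟶ Y) (x : ℕ) : ℕ :=
  f.toOrderHom ⟨min x X.len, by omega⟩

/-- The simplicial operator to which a monotone function on natural numbers restricts. -/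
def ofMonotoneNat (X Y : SimplexCategory) (h : ℕ → ℕ) (hm : Monotone h) (hb : h X.len ≤ Y.len) :
    X ⟶ Y :=
  SimplexCategory.Hom.mk ⟨fun x => ⟨h x, Nat.lt_succ_of_le ((hm (Fin.is_le x)).trans hb)⟩,
    fun _ _ hxy => hm hxy⟩

variable {X Y Z : SimplexCategory}

lemma evalNat_coe (f : X ⟶ Y) (x : Fin (X.len + 1)) : evalNat f x = f.toOrderHom x := by
  simp only [evalNat, min_eq_left (Fin.is_le x)]

lemma evalNat_le (f : X ⟶ Y) (x : ℕ) : evalNat f x ≤ Y.len :=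
  Fin.is_le _

lemma evalNat_mono (f : X ⟶ Y) : Monotone (evalNat f) := fun _ _ h =>
  f.toOrderHom.monotone (Fin.mk_le_mk.2 (min_le_min_right _ h))

lemma evalNat_id (x : ℕ) : evalNat (𝟙 X) x = min x X.len :=
  rfl

lemma evalNat_comp (f : X ⟶ Y) (g : Y ⟶ Z) (x : ℕ) :
    evalNat (f ≫ g) x = evalNat g (evalNat f x) :=
  (evalNat_coe g _).symm

lemma evalNat_ext {f g : X ⟶ Y} (h : ∀ x ≤ X.len, evalNat f x = evalNat g x) : f = g := by
  refine SimplexCategory.Hom.ext _ _ (OrderHom.ext _ _ (funext fun x => Fin.ext ?_))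
  rw [← evalNat_coe, ← evalNat_coe, h x (Fin.is_le x)]

lemma act_iff_evalNat {f : X ⟶ Y} : act f ↔ evalNat f 0 = 0 ∧ evalNat f X.len = Y.len := by
  rw [show evalNat f 0 = f.toOrderHom 0 from evalNat_coe f 0,
    show evalNat f X.len = f.toOrderHom (Fin.last _) from evalNat_coe f (Fin.last _)]
  simp only [act, Fin.ext_iff, Fin.val_last, Fin.val_zero]

lemma inert_iff_evalNat_succ {f : X ⟶ Y} :
    inert f ↔ ∀ x < X.len, evalNat f (x + 1) = evalNat f x + 1 := by
  refine Fin.forall_iff.trans (forall₂_congr fun x hx => ?_)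
  rw [← evalNat_coe, ← evalNat_coe]
  rfl

lemma inert_iff_evalNat {f : X ⟶ Y} :
    inert f ↔ ∀ x ≤ X.len, evalNat f x = evalNat f 0 + x := by
  rw [inert_iff_evalNat_succ]
  refine ⟨fun h x => ?_, fun h x hx => by rw [h _ hx, h x hx.le, add_assoc]⟩
  induction x with
  | zero => simp
  | succ x ih => exact fun hx => by rw [h x hx, ih (Nat.le_of_succ_le hx), add_assoc]

lemma covers_iff_evalNat {f : X ⟶ Y} {i : Fin X.len} {j : Fin Y.len} :
    Covers f i j ↔ evalNat f i ≤ j ∧ (j : ℕ) + 1 ≤ evalNat f (i + 1) := by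
  rw [show evalNat f i = f.toOrderHom i.castSucc from evalNat_coe f i.castSucc,
    show evalNat f (i + 1) = f.toOrderHom i.succ from evalNat_coe f i.succ]
  simp [Covers, Fin.le_def]

/-- The translation `x ↦ a + x`. Every inert morphism of the simplex category is of this form. -/
def shift (X Y : SimplexCategory) (a : ℕ) (h : a + X.len ≤ Y.len) : X ⟶ Y :=
  ofMonotoneNat X Y (a + ·) (fun _ _ hxy => Nat.add_le_add_left hxy a) h

/-- The truncation `x ↦ min (x - a) k`, for `Y = [k]`, where `x - a = 0` for `x ≤ a`. It is the
active retraction of the translation by `a`. -/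
def clamp (X Y : SimplexCategory) (a : ℕ) : X ⟶ Y :=
  ofMonotoneNat X Y (fun x => min (x - a) Y.len)
    (fun _ _ hxy => min_le_min_right _ (Nat.sub_le_sub_right hxy a)) (min_le_right _ _)

lemma evalNat_shift {a : ℕ} (h : a + X.len ≤ Y.len) (x : ℕ) :
    evalNat (shift X Y a h) x = a + min x X.len :=
  rfl

lemma evalNat_clamp (a x : ℕ) : evalNat (clamp X Y a) x = min (min x X.len - a) Y.len :=
  rfl

lemma inert_shift {a : ℕ} (h : a + X.len ≤ Y.len) : inert (shift X Y a h) := by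
  simp only [inert_iff_evalNat, evalNat_shift]
  omega

lemma evalNat_zero_add_len_le {f : X ⟶ Y} (hf : inert f) : evalNat f 0 + X.len ≤ Y.len :=
  inert_iff_evalNat.1 hf _ le_rfl ▸ evalNat_le f _

lemma eq_shift {f : X ⟶ Y} (hf : inert f) :
    f = shift X Y (evalNat f 0) (evalNat_zero_add_len_le hf) :=
  evalNat_ext fun x hx => by rw [inert_iff_evalNat.1 hf x hx, evalNat_shift, min_eq_left hx]

lemma act_clamp {a : ℕ} (h : a + X.len ≤ Y.len) : act (clamp Y X a) := by
  simp only [act_iff_evalNat, evalNat_clamp]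
  omega

lemma shift_comp_clamp {a : ℕ} (h : a + X.len ≤ Y.len) : shift X Y a h ≫ clamp Y X a = 𝟙 X := by
  refine evalNat_ext fun x hx => ?_
  simp only [evalNat_comp, evalNat_shift, evalNat_clamp, evalNat_id]
  omega

lemma eq_clamp_comp_of_act {a : ℕ} {h : a + X.len ≤ Y.len} {f : Y ⟶ Z}
    (hf : act (shift X Y a h ≫ f)) : f = clamp Y X a ≫ shift X Y a h ≫ f := by
  obtain ⟨hf_first, hf_last⟩ := act_iff_evalNat.1 hf
  simp only [evalNat_comp, evalNat_shift, Nat.zero_min, add_zero, min_self] at hf_first hf_last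
  refine evalNat_ext fun x hx => ?_
  simp only [evalNat_comp, evalNat_shift, evalNat_clamp, min_eq_left hx]
  rcases le_total x a with hxa | hax
  · have := evalNat_mono f hxa
    rw [show a + min (min (x - a) X.len) X.len = a by omega]
    omega
  rcases le_total x (a + X.len) with hxb | hbx
  · rw [show a + min (min (x - a) X.len) X.len = x by omega]
  · have := evalNat_mono f hbx
    have := evalNat_le f x
    rw [show a + min (min (x - a) X.len) X.len = a + X.len by omega]
    omega

lemma eq_clamp {a : ℕ} {h : a + X.len ≤ Y.len} {r : Y ⟶ X} (hr : shift X Y a h ≫ r = 𝟙 X) :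
    r = clamp Y X a := by
  have : r = clamp Y X a ≫ shift X Y a h ≫ r :=
    eq_clamp_comp_of_act (hr ▸ act_iff_evalNat.2 ⟨by simp [evalNat_id], by simp [evalNat_id]⟩)
  rwa [hr, Category.comp_id] at this

/-- The active part of a simplicial operator: its corestriction to the interval spanned by its
image. -/
def activePart (f : X ⟶ Y) : X ⟶ ⦋evalNat f X.len - evalNat f 0⦌ :=
  ofMonotoneNat _ _ (fun x => evalNat f x - evalNat f 0)
    (fun _ _ hxy => Nat.sub_le_sub_right (evalNat_mono f hxy) _) le_rfl

lemma evalNat_zero_add_len_activePart_le (f : X ⟶ Y) :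
    evalNat f 0 + (⦋evalNat f X.len - evalNat f 0⦌ : SimplexCategory).len ≤ Y.len := by
  have := evalNat_mono f (Nat.zero_le X.len)
  have := evalNat_le f X.len
  simp only
  omega

lemma evalNat_activePart (f : X ⟶ Y) (x : ℕ) :
    evalNat (activePart f) x = evalNat f (min x X.len) - evalNat f 0 :=
  rfl

lemma act_activePart (f : X ⟶ Y) : act (activePart f) := by
  simp [act_iff_evalNat, evalNat_activePart]

lemma activePart_comp_shift (f : X ⟶ Y) :
    activePart f ≫ shift _ Y (evalNat f 0) (evalNat_zero_add_len_activePart_le f) = f := by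
  refine evalNat_ext fun x hx => ?_
  have := evalNat_mono f (Nat.zero_le x)
  have := evalNat_mono f hx
  simp only [evalNat_comp, evalNat_shift, evalNat_activePart, min_eq_left hx]
  omega

lemma existsUnique_iso_of_fac_eq {Z' : SimplexCategory} {a : X ⟶ Z} {i : Z ⟶ Y} {a' : X ⟶ Z'}
    {i' : Z' ⟶ Y} (ha : act a) (hi : inert i) (ha' : act a') (hi' : inert i')
    (h : a ≫ i = a' ≫ i') : ∃! k : Z ≅ Z', a ≫ k.hom = a' ∧ k.hom ≫ i' = i := by
  have eval_eq : ∀ x, evalNat i (evalNat a x) = evalNat i' (evalNat a' x) := fun x => by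
    rw [← evalNat_comp, ← evalNat_comp, h]
  rw [act_iff_evalNat] at ha ha'
  rw [inert_iff_evalNat] at hi hi'
  have first_eq := eval_eq 0
  have last_eq := eval_eq X.len
  rw [ha.1, ha'.1] at first_eq
  rw [ha.2, ha'.2, hi _ le_rfl, hi' _ le_rfl] at last_eq
  obtain rfl : Z = Z' := SimplexCategory.ext (by omega)
  obtain rfl : i = i' := evalNat_ext fun x hx => by rw [hi x hx, hi' x hx, first_eq]
  obtain rfl : a = a' := evalNat_ext fun x _ => by
    have := eval_eq x
    rw [hi _ (evalNat_le _ _), hi _ (evalNat_le _ _)] at this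
    omega
  exact ⟨Iso.refl _, by simp, fun m _ => iso_eq_iso_refl m⟩

theorem simplex_isMomentCategory : IsMomentCategory SimplexCategory where
  act_of_iso h := by
    obtain rfl := skeletal ⟨h⟩
    rw [iso_eq_iso_refl h]
    exact ⟨rfl, rfl⟩
  inert_of_iso h := by
    obtain rfl := skeletal ⟨h⟩
    rw [iso_eq_iso_refl h]
    exact fun _ => rfl
  act_comp f g hf hg := by
    rw [act_iff_evalNat] at *
    simp only [evalNat_comp, hf, hg, and_self]
  inert_comp {X _ _} f g hf hg := by
    rw [inert_iff_evalNat_succ] at *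
    have := evalNat_zero_add_len_le (inert_iff_evalNat_succ.2 hf)
    intro x hx
    have := inert_iff_evalNat.1 (inert_iff_evalNat_succ.2 hf) x hx.le
    rw [evalNat_comp, evalNat_comp, hf x hx, hg _ (by omega)]
  exists_fac f := ⟨_, activePart f, _, act_activePart f, inert_shift _, activePart_comp_shift f⟩
  fac_unique _ _ _ _ := existsUnique_iso_of_fac_eq
  exists_unique_retraction {X Y} i hi := by
    have hb := evalNat_zero_add_len_le hi
    rw [eq_shift hi]
    exact ⟨clamp Y X _, ⟨act_clamp hb, shift_comp_clamp hb⟩, fun r hr => eq_clamp hr.2⟩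
  eq_retraction_comp i f g r hi _ hg _ hir hif := by
    obtain ⟨a, h, rfl⟩ : ∃ a h, i = shift _ _ a h := ⟨_, _, eq_shift hi⟩
    obtain rfl := eq_clamp hir
    subst hif
    exact eq_clamp_comp_of_act hg

attribute [local instance] simplex_isMomentCategory

lemma existsUnique_act_one (X : SimplexCategory) : ∃! φ : ⦋1⦌ ⟶ X, act φ := by
  let ε : ⦋1⦌ ⟶ X :=
    ofMonotoneNat _ _ (· * X.len) (fun _ _ h => Nat.mul_le_mul_right _ h) (one_mul _).le
  have evalNat_ε : ∀ x, evalNat ε x = min x 1 * X.len := fun _ => rfl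
  refine ⟨ε, by simp [act_iff_evalNat, evalNat_ε], fun φ hφ => evalNat_ext fun x hx => ?_⟩
  simp only [act_iff_evalNat] at hφ hx
  interval_cases x <;> simp [evalNat_ε, hφ]

lemma vertex_add_len_zero_le (a : Fin (X.len + 1)) :
    (a : ℕ) + (⦋0⦌ : SimplexCategory).len ≤ X.len :=
  Fin.is_le a

/-- The moment of `[m]` that is constant with value a given vertex; it splits over `[0]`. -/
def vertexMoment (a : Fin (X.len + 1)) : Moment X :=
  ⟨clamp X ⦋0⦌ a ≫ shift ⦋0⦌ X a (vertex_add_len_zero_le a), isMoment_of_retraction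
    (act_clamp (vertex_add_len_zero_le a)) (inert_shift _) (shift_comp_clamp _)⟩

lemma evalNat_vertexMoment (a : Fin (X.len + 1)) (x : ℕ) : evalNat (vertexMoment a).1 x = a := by
  simp [vertexMoment, evalNat_comp, evalNat_shift]

lemma vertexMoment_injective : Function.Injective (vertexMoment (X := X)) := fun a b h =>
  Fin.ext (by rw [← evalNat_vertexMoment a 0, h, evalNat_vertexMoment])

lemma vertexMoment_congr (a b : Fin (X.len + 1)) : (vertexMoment a).Congr (vertexMoment b) :=
  ⟨evalNat_ext fun x _ => by simp only [evalNat_comp, evalNat_vertexMoment],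
    evalNat_ext fun x _ => by simp only [evalNat_comp, evalNat_vertexMoment]⟩

lemma vertexMoment_ne_id (hX : 0 < X.len) (a : Fin (X.len + 1)) : (vertexMoment a).1 ≠ 𝟙 X := by
  intro h
  have h_first := evalNat_vertexMoment a 0
  have h_last := evalNat_vertexMoment a X.len
  rw [h, evalNat_id] at h_first h_last
  omega

lemma exists_eq_vertexMoment {φ : Moment (⦋1⦌ : SimplexCategory)} (hφ : φ.1 ≠ 𝟙 _) :
    ∃ a, φ = vertexMoment a := by
  have hle := evalNat_le φ.1 1
  have hmono := evalNat_mono φ.1 zero_le_one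
  simp only at hle
  have const : evalNat φ.1 0 = evalNat φ.1 1 := by
    by_contra h
    refine hφ (evalNat_ext fun x hx => ?_)
    simp only at hx
    interval_cases x <;> simp only [evalNat_id] <;> omega
  refine ⟨⟨evalNat φ.1 1, Nat.lt_succ_of_le hle⟩, Subtype.ext (evalNat_ext fun x hx => ?_)⟩
  rw [evalNat_vertexMoment]
  simp only at hx
  interval_cases x
  exacts [const, rfl]

lemma isPrimitive_one : IsPrimitive (⦋1⦌ : SimplexCategory) := by
  refine ⟨⟨vertexMoment 0, vertexMoment_ne_id Nat.one_pos 0⟩, fun φ hφ hc => ?_⟩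
  obtain ⟨a, rfl⟩ := exists_eq_vertexMoment hφ
  obtain ⟨b, hb⟩ : ∃ b : Fin 2, b ≠ a := exists_ne a
  exact hb (vertexMoment_injective (hc (vertexMoment b) (vertexMoment_congr a b)))

lemma segment_add_len_one_le (i : Fin X.len) : (i : ℕ) + (⦋1⦌ : SimplexCategory).len ≤ X.len :=
  i.2

lemma shift_comp_eq_id_iff_covers {f : X ⟶ ⦋1⦌} {i : Fin X.len} :
    shift ⦋1⦌ X i (segment_add_len_one_le i) ≫ f = 𝟙 _ ↔ Covers f i (0 : Fin 1) := by
  have := evalNat_le f (i + 1)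
  simp only [covers_iff_evalNat, Fin.val_zero] at this ⊢
  refine ⟨fun h => ?_, fun h => evalNat_ext fun x hx => ?_⟩
  · have h_first := congrArg (evalNat · 0) h
    have h_last := congrArg (evalNat · 1) h
    simp only [evalNat_comp, evalNat_shift, evalNat_id] at h_first h_last
    simp only [zero_le, min_eq_left, add_zero, min_self] at h_first h_last
    omega
  · simp only at hx
    simp only [evalNat_comp, evalNat_shift, evalNat_id]
    interval_cases x <;> simp only [zero_le, min_eq_left, add_zero, min_self] <;> omega

lemma isUnitObj_one : IsUnitObj (⦋1⦌ : SimplexCategory) := by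
  refine ⟨isPrimitive_one, fun X f hf => ?_⟩
  obtain ⟨φ, hφ, -⟩ := existsUnique_act_one X
  have hφf : φ ≫ f = 𝟙 ⦋1⦌ := (existsUnique_act_one _).unique (act_comp _ _ hφ hf) (act_id _)
  obtain ⟨i, -, hi⟩ := Covers.exists_mid (hφf ▸ covers_id (0 : Fin 1))
  refine ⟨shift _ _ i (segment_add_len_one_le i), ⟨inert_shift _, shift_comp_eq_id_iff_covers.2 hi⟩,
    fun k hk => ?_⟩
  obtain ⟨a, h, rfl⟩ : ∃ a h, k = shift _ _ a h := ⟨_, _, eq_shift hk.1⟩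
  have : i = ⟨a, h⟩ := hi.eq (shift_comp_eq_id_iff_covers.1 hk.2)
  subst this
  rfl

lemma isUnitCover_eq_one : IsUnitCover (· = (⦋1⦌ : SimplexCategory)) where
  isUnitObj h := h ▸ isUnitObj_one
  exists_act X := (existsUnique_act_one X).exists.elim fun φ hφ => ⟨_, φ, rfl, hφ⟩

theorem simplex_isUnital : IsUnital SimplexCategory :=
  isUnitCover_eq_one.isUnital fun {A _ _} φ φ' hU hU' hφ hφ' => by
    subst hU hU'
    exact ⟨Iso.refl _, (existsUnique_act_one A).unique (by simpa using hφ') hφ,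
      fun m _ => iso_eq_iso_refl m⟩

theorem simplex_hasEssentiallyUniqueUnit : HasEssentiallyUniqueUnit SimplexCategory :=
  isUnitCover_eq_one.hasEssentiallyUniqueUnit ⟨_, rfl⟩ fun U U' hU hU' => by
    subst hU hU'
    exact ⟨⟨⟨Iso.refl _⟩, iso_eq_iso_refl⟩⟩

lemma eq_one_of_isUnitObj {U : SimplexCategory} (hU : IsUnitObj U) : U = ⦋1⦌ := by
  obtain ⟨S, rfl, ⟨k⟩⟩ := isUnitCover_eq_one.exists_iso hU
  exact (skeletal ⟨k⟩).symm

/-- The elementary moment of `[m]` that corresponds to the segment `i`. -/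
def segment (i : Fin X.len) : El X :=
  El.ofSplit isUnitObj_one (act_clamp (segment_add_len_one_le i))
    (inert_shift (segment_add_len_one_le i)) (shift_comp_clamp (segment_add_len_one_le i))

lemma exists_comp_shift_eq_shift_iff {a b : ℕ} {ha : a + X.len ≤ Y.len} {hb : b + Z.len ≤ Y.len} :
    (∃ c, c ≫ shift X Y a ha = shift Z Y b hb) ↔ a ≤ b ∧ b + Z.len ≤ a + X.len := by
  constructor
  · rintro ⟨c, hc⟩
    have h_first := congrArg (evalNat · 0) hc
    have h_last := congrArg (evalNat · Z.len) hc
    simp only [evalNat_comp, evalNat_shift] at h_first h_last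
    omega
  · rintro ⟨hab, hba⟩
    refine ⟨shift Z X (b - a) (by omega), evalNat_ext fun x hx => ?_⟩
    simp only [evalNat_comp, evalNat_shift]
    omega

lemma segment_sub_push_iff {f : X ⟶ Y} {i : Fin X.len} {j : Fin Y.len} :
    (segment j).1.Sub (push f (segment i).1) ↔ Covers f i j := by
  let g : ⦋1⦌ ⟶ Y := shift ⦋1⦌ X i (segment_add_len_one_le i) ≫ f
  have hi := segment_add_len_one_le i
  have hj := segment_add_len_one_le j
  rw [Moment.sub_push_iff_exists_comp (act_clamp hi) (inert_shift hi) rfl (act_activePart g)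
    (inert_shift _) (activePart_comp_shift g) (shift_comp_clamp hj) rfl,
    exists_comp_shift_eq_shift_iff, covers_iff_evalNat]
  have := evalNat_mono f (Nat.le_succ i)
  simp only [g, evalNat_comp, evalNat_shift, zero_le, min_eq_left, add_zero, min_self]
  omega

lemma segment_injective : Function.Injective (segment (X := X)) := fun i j h =>
  (segment_sub_push_iff.1 (h ▸ El.sub_push_id (segment i))).eq (covers_id j)

lemma segment_surjective : Function.Surjective (segment (X := X)) := by
  intro α
  obtain ⟨U, r, i, hU, -, hi, hir, e⟩ := α.exists_split
  obtain rfl := eq_one_of_isUnitObj hU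
  obtain ⟨a, h, rfl⟩ : ∃ a h, i = shift ⦋1⦌ X a h := ⟨_, _, eq_shift hi⟩
  obtain rfl := eq_clamp hir
  exact ⟨⟨a, h⟩, El.ext e⟩

/-- The elementary moments of `[m]` are its segments. -/
noncomputable def segmentEquiv (X : SimplexCategory) : Fin X.len ≃ El X :=
  Equiv.ofBijective segment ⟨segment_injective, segment_surjective⟩

lemma covers_segmentEquiv_symm_iff {f : X ⟶ Y} {α : El X} {β : El Y} :
    Covers f ((segmentEquiv X).symm α) ((segmentEquiv Y).symm β) ↔ β.1.Sub (push f α.1) := by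
  obtain ⟨i, rfl⟩ := (segmentEquiv X).surjective α
  obtain ⟨j, rfl⟩ := (segmentEquiv Y).surjective β
  rw [Equiv.symm_apply_apply, Equiv.symm_apply_apply]
  exact segment_sub_push_iff.symm

lemma forall_covers_iff {f : X ⟶ Y} {p : ∀ i j, Covers f i j → Prop} :
    (∀ i j h, p i j h) ↔
      ∀ (α : El X) (β : El Y) (h : β.1.Sub (push f α.1)),
        p _ _ (covers_segmentEquiv_symm_iff.2 h) := by
  refine ⟨fun H α β h => H _ _ _, fun H i j h => ?_⟩
  obtain ⟨α, rfl⟩ := (segmentEquiv X).symm.surjective i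
  obtain ⟨β, rfl⟩ := (segmentEquiv Y).symm.surjective j
  exact H α β (covers_segmentEquiv_symm_iff.1 h)

end Simplex

section Comparison

attribute [local instance] simplex_isUnital

variable {D : Type u₂} [Category.{v₂} D]

lemma DeltaWreath.comp_app {X Y Z : DeltaWreath D} (f : X ⟶ Y) (g : Y ⟶ Z) {i : Fin X.base.len}
    {j : Fin Y.base.len} {k : Fin Z.base.len} (h₁ : Covers (Hom.base f) i j)
    (h₂ : Covers (Hom.base g) j k) (h : Covers (Hom.base f ≫ Hom.base g) i k) :
    Hom.app (f ≫ g) i k h = Hom.app f i j h₁ ≫ Hom.app g j k h₂ :=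
  Hom.comp_app f g i j k h₁ h₂ h

/-- The comparison functor from Joyal's wreath product to that of moment categories, which relabels
the segments of `[m]` as elementary moments. -/
noncomputable def comparison (D : Type u₂) [Category.{v₂} D] :
    DeltaWreath D ⥤ Wreath SimplexCategory D where
  obj X := ⟨X.base, fun α => X.fam ((segmentEquiv X.base).symm α)⟩
  map {X Y} f := (⟨DeltaWreath.Hom.base f, fun α β h =>
    DeltaWreath.Hom.app f _ _ (covers_segmentEquiv_symm_iff.2 h)⟩ : Wreath.Hom _ _)
  map_id X := Wreath.hom_ext rfl fun _ _ _ _ => rfl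
  map_comp {X Y Z} f g := by
    refine Wreath.hom_ext rfl fun α γ h h' => ?_
    obtain ⟨β, h₁, h₂⟩ := El.exists_mid (DeltaWreath.Hom.base f) (DeltaWreath.Hom.base g) α γ h
    exact (DeltaWreath.comp_app f g _ _ (covers_segmentEquiv_symm_iff.2 h)).trans
      (Wreath.comp_app _ _ h₁ h₂ h').symm

lemma Wreath.app_eq_eqToHom_comp {C : Type u₁} [Category.{v₁} C] [ActiveInert C]
    [IsMomentCategory C] {X Y : Wreath C D} (f : X ⟶ Y) {α α' : El X.base} {β β' : El Y.base}
    (hα : α = α') (hβ : β = β') (h : β.1.Sub (push (Hom.base f) α.1)) :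
    Hom.app f α β h = eqToHom (by rw [hα]) ≫ Hom.app f α' β' (by rwa [← hα, ← hβ]) ≫
      eqToHom (by rw [hβ]) := by
  subst hα hβ
  simp

instance : (comparison D).Faithful where
  map_injective {X Y f g} h := by
    have hb : DeltaWreath.Hom.base f = DeltaWreath.Hom.base g := congrArg Wreath.Hom.base h
    have ha (α : El X.base) (β : El Y.base) (h₁ h₂) :
        Wreath.Hom.app ((comparison D).map f) α β h₁ =
          Wreath.Hom.app ((comparison D).map g) α β h₂ := by
      congr 1
    exact DeltaWreath.Hom.ext' f g hb <|
      forall_covers_iff.2 fun α β h₁ h₂ => ha α β h₁ (covers_segmentEquiv_symm_iff.1 h₂)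

instance : (comparison D).Full where
  map_surjective {X Y} g := by
    refine ⟨(⟨Wreath.Hom.base g, fun i j h => eqToHom (by simp [comparison]) ≫
      Wreath.Hom.app g (segmentEquiv X.base i) (segmentEquiv Y.base j)
        (segment_sub_push_iff.2 h) ≫ eqToHom (by simp [comparison])⟩ :
        DeltaWreath.Hom X Y), Wreath.hom_ext rfl fun α β _ h' => ?_⟩
    exact (Wreath.app_eq_eqToHom_comp g ((segmentEquiv X.base).apply_symm_apply α).symm
      ((segmentEquiv Y.base).apply_symm_apply β).symm h').symm

instance : (comparison D).EssSurj where
  mem_essImage X := by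
    refine ⟨⟨X.base, fun i => X.fam (segmentEquiv X.base i)⟩, ⟨eqToIso ?_⟩⟩
    simp [comparison]

instance : (comparison D).IsEquivalence where

variable [ActiveInert D]

lemma comparison_detectsActiveInert : DetectsActiveInert (comparison D) where
  act_iff f := and_congr_right fun _ =>
    (forall_covers_iff (p := fun i j h => act (DeltaWreath.Hom.app f i j h))).symm
  inert_iff f := and_congr_right fun _ =>
    (forall_covers_iff (p := fun i j h => inert (DeltaWreath.Hom.app f i j h))).symm

variable [IsUnital D]

theorem DeltaWreath.isUnital (hD : HasEssentiallyUniqueUnit D) : IsUnital (DeltaWreath D) :=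
  have := Wreath.isUnital (C := SimplexCategory) hD
  comparison_detectsActiveInert.isUnital

theorem DeltaWreath.hasEssentiallyUniqueUnit (hD : HasEssentiallyUniqueUnit D) :
    HasEssentiallyUniqueUnit (DeltaWreath D) :=
  have := Wreath.isUnital (C := SimplexCategory) hD
  comparison_detectsActiveInert.hasEssentiallyUniqueUnit
    (Wreath.hasEssentiallyUniqueUnit simplex_hasEssentiallyUniqueUnit hD)

theorem theta_isUnital_and_hasEssentiallyUniqueUnit {n : ℕ} (hn : 1 ≤ n) :
    IsUnital (Theta n) ∧ HasEssentiallyUniqueUnit (Theta n) := by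
  induction n, hn using Nat.le_induction with
  | base => exact ⟨simplex_isUnital, simplex_hasEssentiallyUniqueUnit⟩
  | succ n hn ih =>
    obtain ⟨_, hn_unit⟩ := ih
    obtain ⟨n, rfl⟩ := Nat.exists_eq_add_of_le' hn
    exact ⟨DeltaWreath.isUnital hn_unit, DeltaWreath.hasEssentiallyUniqueUnit hn_unit⟩

end Comparison

universe v₃ u₃

theorem mainTheorem7_general :
    (∀ (C : Type u₁) [Category.{v₁} C] [ActiveInert C] [IsMomentCategory C]
      (D : Type u₂) [Category.{v₂} D] [ActiveInert D] [IsMomentCategory D],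
      IsMomentCategory (Wreath C D)) ∧
    (∀ (C : Type u₁) [Category.{v₁} C] [ActiveInert C] [IsUnital C]
      (D : Type u₂) [Category.{v₂} D] [ActiveInert D] [IsUnital D],
      HasEssentiallyUniqueUnit D →
        IsUnital (Wreath C D) ∧
        (HasEssentiallyUniqueUnit C → HasEssentiallyUniqueUnit (Wreath C D))) ∧
    (∀ n : ℕ, 1 ≤ n → IsUnital (Theta n) ∧ HasEssentiallyUniqueUnit (Theta n)) ∧
    ∃ _ : IsUnital SimplexCategory,
      ∀ (D : Type u₃) [Category.{v₃} D] [ActiveInert D],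
        ∃ e : DeltaWreath D ≌ Wreath SimplexCategory D,
          ∀ {S T : DeltaWreath D} (f : S ⟶ T),
            (ActiveInert.act (e.functor.map f) ↔ ActiveInert.act f) ∧
            (ActiveInert.inert (e.functor.map f) ↔ ActiveInert.inert f) := by
  have := simplex_isUnital
  refine ⟨fun C _ _ _ D _ _ _ => inferInstance, fun C _ _ _ D _ _ _ hD =>
    ⟨Wreath.isUnital hD, fun hC => Wreath.hasEssentiallyUniqueUnit hC hD⟩,
    fun n hn => theta_isUnital_and_hasEssentiallyUniqueUnit hn, simplex_isUnital,
    fun D _ _ => ⟨(comparison D).asEquivalence, fun f => ?_⟩⟩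
  exact ⟨comparison_detectsActiveInert.act_iff f, comparison_detectsActiveInert.inert_iff f⟩

end MomentCat

theorem mainTheorem7 :
    (∀ (C : Type u₁) [Category.{v₁} C] [ActiveInert C] [IsUnital C]
      (D : Type u₂) [Category.{v₂} D] [ActiveInert D] [IsUnital D],
      IsMomentCategory (Wreath C D) ∧
      (HasEssentiallyUniqueUnit D →
        IsUnital (Wreath C D) ∧
        (HasEssentiallyUniqueUnit C → HasEssentiallyUniqueUnit (Wreath C D)))) ∧
    (∃ _ : IsUnital SimplexCategory, ∀ n : ℕ, 1 ≤ n →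
      IsUnital (Theta n) ∧ HasEssentiallyUniqueUnit (Theta n) ∧
      ∃ e : Theta (n + 1) ≌ Wreath SimplexCategory (Theta n),
        ∀ {S T : Theta (n + 1)} (f : S ⟶ T),
          (ActiveInert.act (e.functor.map f) ↔ ActiveInert.act f) ∧
          (ActiveInert.inert (e.functor.map f) ↔ ActiveInert.inert f)) := by
  obtain ⟨hmoment, hwreath, htheta, hΔ, hcomparison⟩ := mainTheorem7_general
  refine ⟨fun C _ _ _ D _ _ _ => ⟨hmoment C D, hwreath C D⟩, hΔ, fun n hn => ?_⟩
  obtain ⟨n, rfl⟩ := Nat.exists_eq_add_of_le' hn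
  exact ⟨(htheta _ hn).1, (htheta _ hn).2, hcomparison (Theta (n + 1))⟩
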